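/- Let $d,k\ge 1$ be integers. For a piecewise continuously differentiable path $X:[0,1]\to\mathbb R^m$, its $k$-th signature tensor $\sigma^{(k)}(X)\in(\mathbb R^m)^{\otimes k}$ has the entries $$\sigma_{i_1\cdots i_k}(X)=\int_{0\le t_1\le\cdots\le t_k\le 1}dX_{i_1}(t_1)\cdots dX_{i_k}(t_k).$$ Let $C^m_{\rm axis}$ be the path in $\mathbb R^m$ from $0$ to $(1,\dots,1)$ that makes the linear steps $e_1,\dots,e_m$ in this order, and let $C^m_{\rm mono}(t)=(t,t^2,\dots,t^m)$. Let $K$ be an algebraically closed field containing $\mathbb R$, and let $\mathbb P^{d^k-1}$ be the projective space of $(K^d)^{\otimes k}$. For $m\ge 1$ let $\mathcal L_{d,k,m}\subseteq\mathbb P^{d^k-1}$ be the Zariski closure of the image of the rational map $A\mapsto A^{\otimes k}\,\sigma^{(k)}(C^m_{\rm axis})$ on $d\times m$ matrices $A$ over $K$ (for real $A$ this is the $k$-th signature tensor of the piecewise linear path whose steps are the columns of $A$). Let $\mathcal P_{d,k,m}$ be the Zariski closure of the image of $A\mapsto A^{\otimes k}\,\sigma^{(k)}(C^m_{\rm mono})$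 (for real $A$, the $k$-th signature tensor of the polynomial path $t\mapsto\sum_{j=1}^m A_j t^j$, where $A_j$ is the $j$-th column). Let $\nu_k(\mathbb P^{d-1})=\{[v^{\otimes k}] : v\in K^d\setminus\{0\}\}$ be the Veronese variety. Let $G_{d,k}$ be the ideal generated by the shuffle relations $\sigma_I\sigma_J-\sigma_{I\sqcup\!\sqcup J}$, for nonempty words $I,J$ in $\{1,\dots,d\}$ with $|I|+|J|\le k$, in the polynomial ring over $K$ in the variables $\sigma_w$, $1\le|w|\le k$; here $\sigma_{I\sqcup\!\sqcup J}$ is the sum of $\sigma_w$ over all $\binom{|I|+|J|}{|I|}$ interleavings $w$ of $I$ and $J$. Let the universal variety $\mathcal U_{d,k}\subseteq\mathbb P^{d^k-1}$ be the zero set of the homogeneous ideal $G_{d,k}\cap K[\sigma_w:|w|=k]$. Then there are integers $M,M'\ge 1$, depending only on $d$ and $k$ (not on $K$), such that $$\nu_k(\mathbb P^{d-1})=\mathcal L_{d,k,1}\subseteq\mathcal L_{d,k,2}\subseteq\cdots\subseteq\mathcal L_{d,k,M}=\mathcal U_{d,k}\subseteq\mathbb P^{d^k-1},$$ $$\nu_k(\mathbb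 P^{d-1})=\mathcal P_{d,k,1}\subseteq\mathcal P_{d,k,2}\subseteq\cdots\subseteq\mathcal P_{d,k,M'}=\mathcal U_{d,k}\subseteq\mathbb P^{d^k-1}.$$ Both chains stabilize there: $\mathcal L_{d,k,m}=\mathcal U_{d,k}$ for all $m\ge M$, and $\mathcal P_{d,k,m}=\mathcal U_{d,k}$ for all $m\ge M'$. -/

import Mathlib

noncomputable section

namespace SigVar

/-! ### Signature tensors of paths in real space -/

/-- `iteratedIntegral X k w t` is the iterated integral
`∫_{0 ≤ t₁ ≤ ⋯ ≤ t_k ≤ t} dX_{w₁}(t₁) ⋯ dX_{w_k}(t_k)` of the path `X` in `ℝ^d`; the first letter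
of `w` belongs to the innermost integral. -/
def iteratedIntegral {d : ℕ} (X : ℝ → Fin d → ℝ) : (k : ℕ) → (Fin k → Fin d) → ℝ → ℝ
  | 0, _, _ => 1
  | k + 1, w, t =>
      ∫ s in (0 : ℝ)..t,
        iteratedIntegral X k (fun j => w j.castSucc) s * deriv (fun u => X u (w (Fin.last k))) s

/-- The `k`-th signature tensor of the path `X`, restricted to the time interval `[0, 1]`, as an
array of format `d × ⋯ × d` with `k` factors. -/
def signatureTensor {d : ℕ} (k : ℕ) (X : ℝ → Fin d → ℝ) : (Fin k → Fin d) → ℝ :=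
  fun w => iteratedIntegral X k w 1

/-- The canonical axis path in `ℝ^m`: on `[(j-1)/m, j/m]` it makes the unit step `e_j`, at constant
speed. With letters counted from `0`, the coordinate `j` grows linearly from `0` to `1` on
`[j/m, (j+1)/m]` and is constant before and after. -/
def axisPath (m : ℕ) : ℝ → Fin m → ℝ :=
  fun t j => max 0 (min 1 ((m : ℝ) * t - (j : ℝ)))

/-- The canonical monomial path `t ↦ (t, t², …, t^m)` in `ℝ^m`. -/
def monoPath (m : ℕ) : ℝ → Fin m → ℝ :=
  fun t j => t ^ ((j : ℕ) + 1)

/-! ### Projective varieties over a field `K` -/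

/-- The lines spanned by the nonzero vectors of `S`, as a set of points of projective space. -/
def lines {K V : Type*} [Field K] [AddCommGroup V] [Module K V] (S : Set V) :
    Set (Projectivization K V) :=
  {p | ∃ v ∈ S, ∃ hv : v ≠ 0, p = Projectivization.mk K v hv}

/-- The common zeros in projective space of the homogeneous elements of a set `F` of polynomials.
The vanishing of a homogeneous polynomial at a point does not depend on the representative. -/
def projZeros {K ι : Type*} [Field K] (F : Set (MvPolynomial ι K)) :
    Set (Projectivization K (ι → K)) :=
  {p | ∀ f ∈ F, (∃ n : ℕ, f.IsHomogeneous n) → MvPolynomial.eval p.rep f = 0}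

/-- The Zariski closure of a set of points of projective space. -/
def zariskiClosure {K ι : Type*} [Field K] (S : Set (Projectivization K (ι → K))) :
    Set (Projectivization K (ι → K)) :=
  projZeros {f | ∀ p ∈ S, MvPolynomial.eval p.rep f = 0}

/-- The action of a `d × m` matrix `A` over `K` on a real tensor `c` of format `m × ⋯ × m`:
each of the `k` sides of `c` is multiplied by `A`. -/
def matrixAct {K : Type*} [Field K] [Algebra ℝ K] {d m k : ℕ} (A : Matrix (Fin d) (Fin m) K)
    (c : (Fin k → Fin m) → ℝ) : (Fin k → Fin d) → K :=
  fun w => ∑ u : Fin k → Fin m, (∏ l, A (w l) (u l)) * algebraMap ℝ K (c u)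

/-- The piecewise linear signature variety: the Zariski closure of the image of the rational map
sending a `d × m` matrix, whose columns are the steps of a path, to its `k`-th signature tensor. -/
def plVariety (K : Type*) [Field K] [Algebra ℝ K] (d k m : ℕ) :
    Set (Projectivization K ((Fin k → Fin d) → K)) :=
  zariskiClosure (lines (Set.range fun A : Matrix (Fin d) (Fin m) K =>
    matrixAct A (signatureTensor k (axisPath m))))

/-- The polynomial signature variety: the Zariski closure of the image of the rational map
sending a `d × m` matrix, whose `j`-th column holds the coefficients of `t^j` of a polynomial path,
to its `k`-th signature tensor. -/
def polyVariety (K : Type*) [Field K] [Algebra ℝ K] (d k m : ℕ) :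
    Set (Projectivization K ((Fin k → Fin d) → K)) :=
  zariskiClosure (lines (Set.range fun A : Matrix (Fin d) (Fin m) K =>
    matrixAct A (signatureTensor k (monoPath m))))

/-- The Veronese variety: the image of `[v] ↦ [v ⊗ ⋯ ⊗ v]`. -/
def veronese (K : Type*) [Field K] (d k : ℕ) :
    Set (Projectivization K ((Fin k → Fin d) → K)) :=
  lines (Set.range fun (v : Fin d → K) (w : Fin k → Fin d) => ∏ l, v (w l))

/-! ### The universal variety -/

/-- The interleavings of two words, with multiplicities. -/
def shuffle {α : Type*} : List α → List α → List (List α)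
  | [], v => [v]
  | a :: u, [] => [a :: u]
  | a :: u, b :: v =>
      (shuffle u (b :: v)).map (fun w => a :: w) ++ (shuffle (a :: u) v).map (fun w => b :: w)
  termination_by u v => u.length + v.length

/-- The nonempty words of length at most `n` in the alphabet `{1, …, d}`. -/
abbrev Word (d n : ℕ) : Type := {w : List (Fin d) // 1 ≤ w.length ∧ w.length ≤ n}

/-- The coordinate function `σ_w` on the tensors of order at most `n` with constant term `1`:
a variable for `1 ≤ |w| ≤ n`, the constant `1` for the empty word, and `0` for longer words. -/
def coord (K : Type*) [Field K] {d : ℕ} (n : ℕ) (w : List (Fin d)) :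
    MvPolynomial (Word d n) K :=
  if h : 1 ≤ w.length ∧ w.length ≤ n then MvPolynomial.X ⟨w, h⟩
  else if w = [] then 1 else 0

/-- The shuffle linear form `σ_{I ⧢ J}`. -/
def shuffleForm (K : Type*) [Field K] {d : ℕ} (n : ℕ) (I J : List (Fin d)) :
    MvPolynomial (Word d n) K :=
  ((shuffle I J).map (coord K n)).sum

/-- The ideal of the step-`n` free nilpotent Lie group, generated by the shuffle relations
`σ_I σ_J - σ_{I ⧢ J}` for words `I` and `J` with `|I| + |J| ≤ n`. -/
def groupIdeal (K : Type*) [Field K] (d n : ℕ) : Ideal (MvPolynomial (Word d n) K) :=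
  Ideal.span {f | ∃ I J : List (Fin d), 1 ≤ I.length ∧ 1 ≤ J.length ∧ I.length + J.length ≤ n ∧
    f = coord K n I * coord K n J - shuffleForm K n I J}

/-- The universal ideal: the intersection of the ideal of the step-`k` free nilpotent Lie group
with the polynomial ring in the coordinates `σ_w`, `|w| = k`. -/
def universalIdeal (K : Type*) [Field K] (d k : ℕ) :
    Ideal (MvPolynomial (Fin k → Fin d) K) :=
  (groupIdeal K d k).comap
    (MvPolynomial.aeval (R := K) (fun w : Fin k → Fin d => coord K k (List.ofFn w))).toRingHom

/-- The universal variety: the zero set of the universal ideal in projective space. -/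
def universalVariety (K : Type*) [Field K] (d k : ℕ) :
    Set (Projectivization K ((Fin k → Fin d) → K)) :=
  projZeros (universalIdeal K d k : Set (MvPolynomial (Fin k → Fin d) K))

end SigVar

end

/-! Call a function on words a character if it is multiplicative for the shuffle product. Each of
the two path families has its signatures encoded by one real character `τ` on words in ℕ
(`axisLimit`, `monoAux 0`), and a matrix acts by linear substitution of letters, which preserves
characters (`IsCharacter.act`). Characters satisfy the relations generating `groupIdeal`, so every
signature variety lies in the universal variety.

Conversely, let a homogeneous `f` vanish on the tensors from `m` columns, `m` large. The real
vanishing ideals form a descending chain of primes, which stabilizes because strictly nested primes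
of a Noetherian ring have different heights (`exists_sigIdeal_eq`). Real linear functionals on `K`
transfer this to `K`, so the bound does not depend on `K`, and `f` vanishes on the real tensors from
any number of columns. On characters a product of coordinates is a sum over shuffles, so `f` becomes
a linear combination of words (`exists_linearization`). A combination that vanishes on all `act m A
τ` is zero (`eq_zero_of_sum_act_eq_zero`): differentiating in an extra column `s • e_a` at index `j`
and letting `j → ∞` isolates the words ending in `a` and strips that letter. Hence `f` vanishes on
all characters over `K`. Every zero of `groupIdeal` is a truncated character and extends to a full
one by solving `∂g = g * p` (`exists_isCharacter_eq`), so the Nullstellensatz puts a power of `f`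
into the universal ideal.

At the start of the chain, one column gives `v^{⊗k}` up to a nonzero scalar, and explicit equations
show that the Veronese variety is closed. -/

namespace SigVar

open Finset Filter Topology

/-! ### Shuffles, deconcatenation and characters -/

section Characters

variable {α R : Type*} [CommRing R]

/-- The sum of the values of `h` on the interleavings of two words. -/
def shuffleSum (h : List α → R) (I J : List α) : R := ((shuffle I J).map h).sum

@[simp] theorem shuffleSum_nil_left (h : List α → R) (J : List α) : shuffleSum h [] J = h J := by
  simp [shuffleSum, shuffle]

@[simp] theorem shuffleSum_nil_right (h : List α → R) (I : List α) : shuffleSum h I [] = h I := by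
  cases I <;> simp [shuffleSum, shuffle]

theorem shuffleSum_cons (h : List α → R) (a b : α) (u v : List α) :
    shuffleSum h (a :: u) (b :: v) =
      shuffleSum (fun w => h (a :: w)) u (b :: v) + shuffleSum (fun w => h (b :: w)) (a :: u) v := by
  simp [shuffleSum, shuffle, Function.comp_def]

theorem shuffleSum_add (g h : List α → R) (I J : List α) :
    shuffleSum (fun w => g w + h w) I J = shuffleSum g I J + shuffleSum h I J := by
  simp [shuffleSum, List.sum_map_add]

theorem shuffleSum_const_mul (c : R) (h : List α → R) (I J : List α) :
    shuffleSum (fun w => c * h w) I J = c * shuffleSum h I J := by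
  simp [shuffleSum, List.sum_map_mul_left]

theorem shuffleSum_finset_sum {ι : Type*} (s : Finset ι) (h : ι → List α → R) (I J : List α) :
    shuffleSum (fun w => ∑ i ∈ s, h i w) I J = ∑ i ∈ s, shuffleSum (h i) I J := by
  classical
  induction s using Finset.induction_on with
  | empty => simp [shuffleSum]
  | insert a s ha ih => simp only [Finset.sum_insert ha, shuffleSum_add, ih]

theorem perm_of_mem_shuffle : ∀ (I J : List α), ∀ w ∈ shuffle I J, w.Perm (I ++ J)
  | [], J, w, hw => by simp_all [shuffle]
  | a :: u, [], w, hw => by simp_all [shuffle]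
  | a :: u, b :: v, w, hw => by
    simp only [shuffle, List.mem_append, List.mem_map] at hw
    rcases hw with ⟨x, hx, rfl⟩ | ⟨x, hx, rfl⟩
    · simpa using perm_of_mem_shuffle u (b :: v) x hx
    · refine ((perm_of_mem_shuffle (a :: u) v x hx).cons b).trans ?_
      exact (List.perm_middle (l₁ := a :: u)).symm
  termination_by I J => I.length + J.length

/-- Used to pull length and weight, which are constant on the interleavings of two words, out of a
shuffle sum. -/
theorem shuffleSum_congr {g h : List α → R} {I J : List α}
    (H : ∀ w, w.Perm (I ++ J) → g w = h w) : shuffleSum g I J = shuffleSum h I J := by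
  unfold shuffleSum
  congr 1
  exact List.map_congr_left fun w hw => H w (perm_of_mem_shuffle I J w hw)

theorem map_shuffleSum {R' : Type*} [CommRing R'] (φ : R →+* R') (h : List α → R) (I J : List α) :
    shuffleSum (fun w => φ (h w)) I J = φ (shuffleSum h I J) := by
  simp [shuffleSum, map_list_sum, Function.comp_def]

/-- The sum of `F u v` over all factorizations `w = u ++ v`. -/
def splitSum (F : List α → List α → R) (w : List α) : R :=
  ∑ i ∈ range (w.length + 1), F (w.take i) (w.drop i)

@[simp] theorem splitSum_nil (F : List α → List α → R) : splitSum F [] = F [] [] := by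
  simp [splitSum]

theorem splitSum_cons (F : List α → List α → R) (a : α) (w : List α) :
    splitSum F (a :: w) = F [] (a :: w) + splitSum (fun u v => F (a :: u) v) w := by
  simp only [splitSum, List.length_cons]
  rw [Finset.sum_range_succ', add_comm]
  simp

theorem splitSum_append_singleton (F : List α → List α → R) (w : List α) (a : α) :
    splitSum F (w ++ [a]) = splitSum (fun u v => F u (v ++ [a])) w + F (w ++ [a]) [] := by
  induction w generalizing F with
  | nil => simp [splitSum_cons]
  | cons b w ih => rw [List.cons_append, splitSum_cons, ih, splitSum_cons]; simp [add_assoc]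

theorem splitSum_add (F G : List α → List α → R) (w : List α) :
    splitSum (fun u v => F u v + G u v) w = splitSum F w + splitSum G w := by
  simp [splitSum, Finset.sum_add_distrib]

theorem splitSum_mul_left (c : R) (F : List α → List α → R) (w : List α) :
    splitSum (fun u v => c * F u v) w = c * splitSum F w := by
  simp [splitSum, Finset.mul_sum]

theorem splitSum_mul_right (c : R) (F : List α → List α → R) (w : List α) :
    splitSum (fun u v => F u v * c) w = splitSum F w * c := by
  simp [splitSum, Finset.sum_mul]

theorem splitSum_congr {F G : List α → List α → R} {w : List α}
    (H : ∀ u v, u ++ v = w → F u v = G u v) : splitSum F w = splitSum G w :=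
  Finset.sum_congr rfl fun i _ => H _ _ (List.take_append_drop i w)

theorem splitSum_eq_single_nil_right {F : List α → List α → R} {w : List α}
    (H : ∀ u v, u ++ v = w → v ≠ [] → F u v = 0) : splitSum F w = F w [] := by
  unfold splitSum
  rw [Finset.sum_eq_single w.length]
  · simp
  · intro i hi hne
    apply H _ _ (List.take_append_drop i w)
    have := Finset.mem_range.1 hi
    intro h
    have := congrArg List.length h
    simp at this
    omega
  · simp

theorem splitSum_eq_single_nil_left {F : List α → List α → R} {w : List α}
    (H : ∀ u v, u ++ v = w → u ≠ [] → F u v = 0) : splitSum F w = F [] w := by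
  unfold splitSum
  rw [Finset.sum_eq_single 0]
  · simp
  · intro i hi hne
    apply H _ _ (List.take_append_drop i w)
    have := Finset.mem_range.1 hi
    intro h
    rcases List.take_eq_nil_iff.1 h with h | h
    · exact hne h
    · subst h
      simp at this
      exact hne this
  · simp

/-- The convolution product of two functions on words, dual to deconcatenation. -/
def conv (g h : List α → R) (w : List α) : R := splitSum (fun u v => g u * h v) w

theorem conv_cons (g h : List α → R) (a : α) (w : List α) :
    conv g h (a :: w) = g [] * h (a :: w) + conv (fun u => g (a :: u)) h w :=
  splitSum_cons _ a w

theorem conv_append_singleton (g h : List α → R) (w : List α) (a : α) :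
    conv g h (w ++ [a]) = conv g (fun v => h (v ++ [a])) w + g (w ++ [a]) * h [] :=
  splitSum_append_singleton _ w a

/-- Deconcatenation is a homomorphism for the shuffle product. -/
theorem shuffleSum_conv (g h : List α → R) : ∀ I J : List α,
    shuffleSum (conv g h) I J =
      splitSum (fun I₁ I₂ => splitSum (fun J₁ J₂ => shuffleSum g I₁ J₁ * shuffleSum h I₂ J₂) J) I
  | [], J => by simp [conv]
  | a :: u, [] => by simp [conv]
  | a :: u, b :: v => by
    rw [shuffleSum_cons]
    simp only [conv_cons, shuffleSum_add, shuffleSum_const_mul]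
    have h1 := shuffleSum_conv (fun w => g (a :: w)) h u (b :: v)
    have h2 := shuffleSum_conv (fun w => g (b :: w)) h (a :: u) v
    simp only [splitSum_cons, shuffleSum_nil_left, shuffleSum_nil_right] at h1 h2 ⊢
    rw [h1, h2]
    simp only [shuffleSum_cons, add_mul, splitSum_add]
    ring
  termination_by I J => I.length + J.length

/-- The functions on words that are multiplicative for the shuffle product. -/
structure IsCharacter (g : List α → R) : Prop where
  nil : g [] = 1
  shuffle : ∀ I J, shuffleSum g I J = g I * g J

theorem IsCharacter.conv {g h : List α → R} (hg : IsCharacter g) (hh : IsCharacter h) :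
    IsCharacter (conv g h) := by
  refine ⟨by simp [SigVar.conv, hg.nil, hh.nil], fun I J => ?_⟩
  rw [shuffleSum_conv]
  simp only [hg.shuffle, hh.shuffle, SigVar.conv]
  rw [← splitSum_mul_right]
  refine splitSum_congr fun I₁ I₂ _ => ?_
  rw [← splitSum_mul_left]
  refine splitSum_congr fun J₁ J₂ _ => ?_
  ring

theorem IsCharacter.map {R' : Type*} [CommRing R'] (φ : R →+* R') {g : List α → R}
    (hg : IsCharacter g) : IsCharacter (fun w => φ (g w)) :=
  ⟨by simp [hg.nil], fun I J => by rw [map_shuffleSum, hg.shuffle, map_mul]⟩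

/-- Infinitesimal characters: functions that vanish on the empty word and on proper shuffles. -/
structure IsPrimitive (p : List α → R) : Prop where
  nil : p [] = 0
  shuffle : ∀ I J, I ≠ [] → J ≠ [] → shuffleSum p I J = 0

theorem isPrimitive_of_length_ne_one {p : List α → R} (hp : ∀ w, w.length ≠ 1 → p w = 0) :
    IsPrimitive p := by
  refine ⟨hp _ (by simp), fun I J hI hJ => ?_⟩
  rw [shuffleSum_congr (h := fun _ => (0 : R) * 0), shuffleSum_const_mul, zero_mul]
  intro w hw
  have := hw.length_eq
  have := List.length_pos_of_ne_nil hI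
  have := List.length_pos_of_ne_nil hJ
  rw [mul_zero]
  apply hp
  simp at *
  omega

/-- A Leibniz rule: when `p` kills proper shuffles, only the splittings with a suffix from a single
word survive. The extra term `q` leaves room for an induction in which `p` is not yet known to kill
the full shuffle of `I` and `J`. -/
theorem shuffleSum_conv_of_ne_nil {g p : List α → R} (h0 : p [] = 0) {I J : List α} {q : R}
    (hI : I ≠ []) (hJ : J ≠ [])
    (hp : ∀ I₁ I₂ J₁ J₂, I₁ ++ I₂ = I → J₁ ++ J₂ = J → I₂ ≠ [] → J₂ ≠ [] →
      shuffleSum g I₁ J₁ * shuffleSum p I₂ J₂ = if I₁ = [] ∧ J₁ = [] then q else 0) :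
    shuffleSum (conv g p) I J = q +
      (splitSum (fun I₁ I₂ => shuffleSum g I₁ J * p I₂) I +
        splitSum (fun J₁ J₂ => shuffleSum g I J₁ * p J₂) J) := by
  classical
  have key : shuffleSum (conv g p) I J = splitSum (fun I₁ I₂ => splitSum (fun J₁ J₂ =>
      (if I₁ = [] ∧ J₁ = [] then q else 0) +
      (shuffleSum g I₁ J₁ * (if J₂ = [] then p I₂ else 0) +
      shuffleSum g I₁ J₁ * (if I₂ = [] then p J₂ else 0))) J) I := by
    rw [shuffleSum_conv]
    refine splitSum_congr fun I₁ I₂ eI => splitSum_congr fun J₁ J₂ eJ => ?_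
    by_cases h1 : I₂ = []
    · have h3 : I₁ ≠ [] := by rintro rfl; simp_all
      by_cases h2 : J₂ = []
      · simp [h1, h2, h0, h3]
      · simp [h1, h2, h3]
    · by_cases h2 : J₂ = []
      · have h3 : J₁ ≠ [] := by rintro rfl; simp_all
        simp [h1, h2, h3]
      · simp [h1, h2, hp I₁ I₂ J₁ J₂ eI eJ h1 h2]
  rw [key]
  simp only [splitSum_add]
  congr 1
  · rw [splitSum_eq_single_nil_left, splitSum_eq_single_nil_left]
    · simp
    · intro u v _ hu
      simp [hu]
    · intro u v _ hu
      simp [hu, splitSum]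
  congr 1
  · refine splitSum_congr fun I₁ I₂ _ => ?_
    rw [splitSum_eq_single_nil_right]
    · simp
    · intro u v _ hv
      simp [hv]
  · rw [splitSum_eq_single_nil_right]
    · simp
    · intro u v _ hv
      simp [hv, splitSum]

/-- Induction on the total length. By the Leibniz rule and the induction hypothesis, the weight of
`I ++ J` times the shuffle sum equals (weight of `I` + weight of `J`) times `g I * g J`; the weight
is then cancelled. -/
theorem shuffleSum_eq_of_conv [IsDomain R] {g p : List α → R} {wt : α → R} (h1 : g [] = 1)
    (hp : IsPrimitive p) (hconv : ∀ w, conv g p w = (w.map wt).sum * g w)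
    (hwt : ∀ w : List α, w ≠ [] → (w.map wt).sum ≠ 0) :
    ∀ I J : List α, shuffleSum g I J = g I * g J
  | [], J => by simp [h1]
  | a :: u, [] => by simp [h1]
  | a :: u, b :: v => by
    have e1 : shuffleSum (conv g p) (a :: u) (b :: v) =
        (((a :: u) ++ (b :: v)).map wt).sum * shuffleSum g (a :: u) (b :: v) := by
      rw [← shuffleSum_const_mul]
      refine shuffleSum_congr fun w hw => ?_
      rw [hconv, (hw.map wt).sum_eq]
    rw [shuffleSum_conv_of_ne_nil (q := 0) hp.nil (by simp) (by simp)
      (fun I₁ I₂ J₁ J₂ _ _ h2 h3 => by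
        rw [hp.shuffle _ _ h2 h3, mul_zero, ite_self]), zero_add] at e1
    have e2 : splitSum (fun I₁ I₂ => shuffleSum g I₁ (b :: v) * p I₂) (a :: u) =
        ((a :: u).map wt).sum * g (a :: u) * g (b :: v) := by
      rw [← hconv, conv, ← splitSum_mul_right]
      refine splitSum_congr fun I₁ I₂ h => ?_
      by_cases hI : I₂ = []
      · simp [hI, hp.nil]
      · have hlt : I₁.length < u.length + 1 := by
          have := congrArg List.length h
          have := List.length_pos_of_ne_nil hI
          simp at *
          omega
        rw [shuffleSum_eq_of_conv h1 hp hconv hwt I₁ (b :: v)]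
        ring
    have e3 : splitSum (fun J₁ J₂ => shuffleSum g (a :: u) J₁ * p J₂) (b :: v) =
        ((b :: v).map wt).sum * g (b :: v) * g (a :: u) := by
      rw [← hconv, conv, ← splitSum_mul_right]
      refine splitSum_congr fun J₁ J₂ h => ?_
      by_cases hJ : J₂ = []
      · simp [hJ, hp.nil]
      · have hlt : J₁.length < v.length + 1 := by
          have := congrArg List.length h
          have := List.length_pos_of_ne_nil hJ
          simp at *
          omega
        rw [shuffleSum_eq_of_conv h1 hp hconv hwt (a :: u) J₁]
        ring
    rw [e2, e3] at e1
    refine mul_left_cancel₀ (hwt ((a :: u) ++ (b :: v)) (by simp)) ?_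
    rw [← e1, List.map_append, List.sum_append]
    ring
  termination_by I J => I.length + J.length

/-- A solution of the differential equation `∂g = g * p`, where `∂` is the derivation given by a
weight and `p` is primitive, is a character. -/
theorem isCharacter_of_conv [IsDomain R] {g p : List α → R} {wt : α → R} (h1 : g [] = 1)
    (hp : IsPrimitive p) (hconv : ∀ w, conv g p w = (w.map wt).sum * g w)
    (hwt : ∀ w : List α, w ≠ [] → (w.map wt).sum ≠ 0) : IsCharacter g :=
  ⟨h1, shuffleSum_eq_of_conv h1 hp hconv hwt⟩

end Characters

/-! ### Extension of truncated characters -/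

section Extension

variable {α K : Type*} [Field K]

/-- The logarithmic derivative of `g` for the grading by length, truncated at level `k`. -/
def logDer (g : List α → K) (k : ℕ) (w : List α) : K :=
  if w.length ≤ k then
    w.length * g w - ∑ i : Fin w.length, g (w.take (i + 1)) * logDer g k (w.drop (i + 1))
  else 0
  termination_by w.length
  decreasing_by simp only [List.length_drop]; omega

/-- The solution of the equation `∂g = g * p` for the grading by length. -/
def expInt (p : List α → K) (w : List α) : K :=
  if w.length = 0 then 1
  else (w.length : K)⁻¹ * ∑ i : Fin w.length, expInt p (w.take i) * p (w.drop i)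
  termination_by w.length
  decreasing_by simp

theorem conv_logDer {g : List α → K} {k : ℕ} (h1 : g [] = 1) {w : List α} (hw : w.length ≤ k) :
    conv g (logDer g k) w = w.length * g w := by
  rw [conv, splitSum, Finset.sum_range_succ', Finset.sum_range]
  simp only [List.take_zero, List.drop_zero, h1, one_mul]
  rw [logDer.eq_def g k w, if_pos hw]
  ring

theorem conv_expInt [CharZero K] {p : List α → K} (h0 : p [] = 0) (w : List α) :
    conv (expInt p) p w = w.length * expInt p w := by
  rw [conv, splitSum, Finset.sum_range_succ, Finset.sum_range]
  -- The splitting with empty suffix, absent from the recursion, contributes nothing as `p [] = 0`.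
  rw [List.drop_length, h0, mul_zero, add_zero]
  by_cases hw : w.length = 0
  · rw [List.length_eq_zero_iff] at hw
    subst hw
    simp
  · rw [expInt.eq_def p w, if_neg hw, mul_inv_cancel_left₀]
    exact_mod_cast hw

theorem sum_map_one (w : List α) : (w.map (fun _ => (1 : K))).sum = w.length := by
  induction w with
  | nil => simp
  | cons a w ih => simp [add_comm]

/-- Induction on `n = |I| + |J|`. For `n ≤ k` the Leibniz rule reads `n g(I) g(J) = q + |I| g(I)
g(J) + |J| g(J) g(I)` with `q` the value sought, so `q = 0`. For `n > k` the truncation makes every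
term zero. -/
theorem isPrimitive_logDer {g : List α → K} {k : ℕ} (h1 : g [] = 1)
    (hg : ∀ I J : List α, I.length + J.length ≤ k → shuffleSum g I J = g I * g J) :
    IsPrimitive (logDer g k) := by
  have h0 : logDer g k [] = 0 := by rw [logDer]; simp
  refine ⟨h0, ?_⟩
  suffices H : ∀ n (I J : List α), I.length + J.length = n → I ≠ [] → J ≠ [] →
      shuffleSum (logDer g k) I J = 0 from fun I J => H _ I J rfl
  intro n
  induction n using Nat.strong_induction_on with
  | _ n ih =>
  intro I J hn hI hJ
  by_cases hk : n ≤ k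
  · have e1 : shuffleSum (conv g (logDer g k)) I J = n * (g I * g J) := by
      rw [← hg I J (by omega), ← shuffleSum_const_mul]
      refine shuffleSum_congr fun w hw => ?_
      have := hw.length_eq
      rw [List.length_append, hn] at this
      rw [conv_logDer h1 (by omega), this]
    have e2 := shuffleSum_conv_of_ne_nil (g := g) (q := shuffleSum (logDer g k) I J) h0 hI hJ
      (fun I₁ I₂ J₁ J₂ eI eJ h2 h3 => by
        by_cases h4 : I₁ = [] ∧ J₁ = []
        · obtain ⟨rfl, rfl⟩ := h4
          simp_all
        · rw [if_neg h4, ih (I₂.length + J₂.length) _ _ _ rfl h2 h3, mul_zero]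
          have l1 := congrArg List.length eI
          have l2 := congrArg List.length eJ
          have l3 : I₁.length ≠ 0 ∨ J₁.length ≠ 0 := by
            simp only [ne_eq, List.length_eq_zero_iff]
            tauto
          simp only [List.length_append] at l1 l2
          omega)
    have e3 : splitSum (fun I₁ I₂ => shuffleSum g I₁ J * logDer g k I₂) I =
        I.length * g I * g J := by
      rw [← conv_logDer (k := k) h1 (by omega), conv, ← splitSum_mul_right]
      refine splitSum_congr fun I₁ I₂ h => ?_
      have l1 := congrArg List.length h
      simp only [List.length_append] at l1
      rw [hg _ _ (by omega)]
      ring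
    have e4 : splitSum (fun J₁ J₂ => shuffleSum g I J₁ * logDer g k J₂) J =
        J.length * g J * g I := by
      rw [← conv_logDer (k := k) h1 (by omega), conv, ← splitSum_mul_right]
      refine splitSum_congr fun I₁ I₂ h => ?_
      have l1 := congrArg List.length h
      simp only [List.length_append] at l1
      rw [hg _ _ (by omega)]
      ring
    rw [e1, e3, e4, ← hn] at e2
    push_cast at e2
    linear_combination -e2
  · rw [shuffleSum_congr (h := fun _ => (0 : K) * 0), shuffleSum_const_mul, zero_mul]
    intro w hw
    have := hw.length_eq
    rw [List.length_append, hn] at this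
    rw [logDer.eq_def, if_neg (by omega), mul_zero]

/-- Both functions solve the same equation, which determines a value from those on shorter words
because the length is invertible. -/
theorem expInt_logDer [CharZero K] {g : List α → K} {k : ℕ} (h1 : g [] = 1) {w : List α}
    (hw : w.length ≤ k) : expInt (logDer g k) w = g w := by
  have h0 : logDer g k [] = 0 := by rw [logDer]; simp
  induction hn : w.length using Nat.strong_induction_on generalizing w with
  | _ n ih =>
  rcases eq_or_ne w [] with rfl | hne
  · simp [expInt, h1]
  have hne' : ((w.length : ℕ) : K) ≠ 0 := by
    exact_mod_cast (List.length_pos_of_ne_nil hne).ne'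
  refine mul_left_cancel₀ hne' ?_
  rw [← conv_expInt h0, ← conv_logDer h1 hw]
  refine splitSum_congr fun u v huv => ?_
  by_cases hv : v = []
  · simp [hv, h0]
  · have l1 := congrArg List.length huv
    have l2 := List.length_pos_of_ne_nil hv
    simp only [List.length_append] at l1
    rw [ih u.length (by omega) (w := u) (by omega) rfl]

/-- A function that satisfies the shuffle relations up to length `k` agrees up to length `k` with
a character. -/
theorem exists_isCharacter_eq [CharZero K] {g : List α → K} {k : ℕ} (h1 : g [] = 1)
    (hg : ∀ I J : List α, I.length + J.length ≤ k → shuffleSum g I J = g I * g J) :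
    ∃ h : List α → K, IsCharacter h ∧ ∀ w : List α, w.length ≤ k → h w = g w := by
  refine ⟨expInt (logDer g k), ?_, fun w => expInt_logDer h1⟩
  have hp := isPrimitive_logDer h1 hg
  refine isCharacter_of_conv (wt := fun _ => 1) (by simp [expInt]) hp (fun w => ?_) fun w hw => ?_
  · rw [conv_expInt hp.nil, sum_map_one]
  · rw [sum_map_one]
    exact_mod_cast (List.length_pos_of_ne_nil hw).ne'

end Extension

/-! ### The action of matrices on functions of words -/

section Action

variable {β R : Type*} [CommRing R]

/-- The action of a matrix with columns indexed by `0, …, m - 1` on a function of words: every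
letter is replaced by a linear combination of letters. -/
def act (m : ℕ) (A : β → ℕ → R) : (List ℕ → R) → List β → R
  | h, [] => h []
  | h, a :: w => ∑ i ∈ range m, A a i * act m A (fun u => h (i :: u)) w

theorem act_add (m : ℕ) (A : β → ℕ → R) (g h : List ℕ → R) (w : List β) :
    act m A (fun u => g u + h u) w = act m A g w + act m A h w := by
  induction w generalizing g h with
  | nil => rfl
  | cons a w ih => simp only [act, ih, mul_add, Finset.sum_add_distrib]

theorem act_const_mul (m : ℕ) (A : β → ℕ → R) (c : R) (h : List ℕ → R) (w : List β) :
    act m A (fun u => c * h u) w = c * act m A h w := by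
  induction w generalizing h with
  | nil => rfl
  | cons a w ih => simp only [act, ih, Finset.mul_sum, mul_left_comm]

theorem act_mul_const (m : ℕ) (A : β → ℕ → R) (c : R) (h : List ℕ → R) (w : List β) :
    act m A (fun u => h u * c) w = act m A h w * c := by
  simp only [mul_comm _ c, act_const_mul]

theorem act_finset_sum {ι : Type*} (s : Finset ι) (m : ℕ) (A : β → ℕ → R) (h : ι → List ℕ → R)
    (w : List β) : act m A (fun u => ∑ i ∈ s, h i u) w = ∑ i ∈ s, act m A (h i) w := by
  induction w generalizing h with
  | nil => rfl
  | cons a w ih =>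
    simp only [act, ih, Finset.mul_sum]
    exact Finset.sum_comm

/-- Interleaving only moves positions, so it commutes with a substitution made letter by letter. -/
theorem shuffleSum_act (m : ℕ) (A : β → ℕ → R) : ∀ (h : List ℕ → R) (I J : List β),
    shuffleSum (act m A h) I J = act m A (fun P => act m A (fun Q => shuffleSum h P Q) J) I
  | h, [], J => by simp [act]
  | h, a :: u, [] => by simp [act]
  | h, a :: u, b :: v => by
    rw [shuffleSum_cons]
    simp only [act, shuffleSum_finset_sum, shuffleSum_const_mul]
    have h1 := fun i => shuffleSum_act m A (fun w => h (i :: w)) u (b :: v)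
    have h2 := fun j => shuffleSum_act m A (fun w => h (j :: w)) (a :: u) v
    simp only [h1, h2, shuffleSum_cons, act_add, mul_add, Finset.sum_add_distrib, act_finset_sum,
      act_const_mul]
    simp only [act, act_finset_sum, act_const_mul, Finset.mul_sum]
    congr 1
    rw [Finset.sum_comm]
    refine Finset.sum_congr rfl fun i _ => Finset.sum_congr rfl fun j _ => ?_
    rw [mul_left_comm]
  termination_by _ I J => I.length + J.length

theorem IsCharacter.act {h : List ℕ → R} (hh : IsCharacter h) (m : ℕ) (A : β → ℕ → R) :
    IsCharacter (act m A h) := by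
  refine ⟨hh.nil, fun I J => ?_⟩
  rw [shuffleSum_act]
  simp only [hh.shuffle, act_const_mul, act_mul_const]

theorem act_succ_of_eq_zero {m : ℕ} {A : β → ℕ → R} (hA : ∀ a, A a m = 0) (h : List ℕ → R)
    (w : List β) : act (m + 1) A h w = act m A h w := by
  induction w generalizing h with
  | nil => rfl
  | cons a w ih => simp only [act, Finset.sum_range_succ, hA, zero_mul, add_zero, ih]

theorem act_congr_matrix {m : ℕ} {A B : β → ℕ → R} (hA : ∀ a, ∀ i < m, A a i = B a i)
    (h : List ℕ → R) (w : List β) : act m A h w = act m B h w := by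
  induction w generalizing h with
  | nil => rfl
  | cons a w ih =>
    simp only [act, ih]
    exact Finset.sum_congr rfl fun i hi => by rw [hA a i (Finset.mem_range.1 hi)]

theorem map_act {R' : Type*} [CommRing R'] (φ : R →+* R') (m : ℕ) (A : β → ℕ → R)
    (h : List ℕ → R) (w : List β) :
    act m (fun a i => φ (A a i)) (fun u => φ (h u)) w = φ (act m A h w) := by
  induction w generalizing h with
  | nil => rfl
  | cons a w ih => simp only [act, ih, map_sum, map_mul]

/-- Links the recursive action on words to the tensor formula in `matrixAct`. -/
theorem act_ofFn {k m : ℕ} (A : β → ℕ → R) (h : List ℕ → R) (w : Fin k → β) :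
    act m A h (List.ofFn w) =
      ∑ u : Fin k → Fin m, (∏ l, A (w l) (u l)) * h (List.ofFn fun l => (u l : ℕ)) := by
  induction k generalizing h with
  | zero => simp [act]
  | succ k ih =>
    rw [List.ofFn_succ, act, ← (Fin.consEquiv fun _ => Fin m).sum_comp, Fintype.sum_prod_type,
      Finset.sum_range]
    refine Finset.sum_congr rfl fun i _ => ?_
    rw [ih, Finset.mul_sum]
    refine Finset.sum_congr rfl fun u _ => ?_
    simp [Fin.prod_univ_succ, List.ofFn_succ, mul_assoc]

end Action

/-! ### Nondegeneracy -/

section Nondegenerate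

variable {β : Type*}

/-- The part of `act (m + 1) A h w` that is linear in an additional column, which is the vector
`e_a` and is assigned the letter `j`. -/
def actLinear [DecidableEq β] (m : ℕ) (A : β → ℕ → ℝ) (a : β) (j : ℕ) :
    (List ℕ → ℝ) → List β → ℝ
  | _, [] => 0
  | h, b :: w => (if b = a then act m A (fun u => h (j :: u)) w else 0) +
      ∑ i ∈ range m, A b i * actLinear m A a j (fun u => h (i :: u)) w

/-- `actRight m A a h (u ++ [a]) = act m A h u`, and `actRight m A a h` vanishes on the other
words. -/
def actRight [DecidableEq β] (m : ℕ) (A : β → ℕ → ℝ) (a : β) : (List ℕ → ℝ) → List β → ℝ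
  | _, [] => 0
  | h, b :: w => (if b = a ∧ w = [] then h [] else 0) +
      ∑ i ∈ range m, A b i * actRight m A a (fun u => h (i :: u)) w

theorem actRight_append_singleton [DecidableEq β] (m : ℕ) (A : β → ℕ → ℝ) (a b : β)
    (h : List ℕ → ℝ) (w : List β) :
    actRight m A a h (w ++ [b]) = if b = a then act m A h w else 0 := by
  induction w generalizing h with
  | nil => simp [actRight, act]
  | cons c w ih =>
    simp only [List.cons_append, actRight, act, ih]
    split_ifs <;> simp_all

/-- The matrix `A` with an additional column `s • e_a` at index `j`; the columns from `m` to
`j - 1` are zero. -/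
def addColumn [DecidableEq β] (m : ℕ) (A : β → ℕ → ℝ) (a : β) (j : ℕ) (s : ℝ) : β → ℕ → ℝ :=
  fun b i => if i < m then A b i else if b = a ∧ i = j then s else 0

theorem sum_range_addColumn [DecidableEq β] {m j : ℕ} (hj : m ≤ j) (A : β → ℕ → ℝ) (a b : β)
    (s : ℝ) (F : ℕ → ℝ) : ∑ i ∈ range (j + 1), addColumn m A a j s b i * F i =
      (if b = a then s * F j else 0) + ∑ i ∈ range m, A b i * F i := by
  rw [Finset.sum_range_succ, add_comm]
  congr 1
  · simp [addColumn, not_lt.2 hj]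
  · rw [← Finset.sum_subset (Finset.range_mono hj)]
    · refine Finset.sum_congr rfl fun i hi => ?_
      simp [addColumn, Finset.mem_range.1 hi]
    · intro i hi hi'
      simp only [Finset.mem_range] at hi hi'
      simp [addColumn, hi', hi.ne]

theorem act_addColumn_zero [DecidableEq β] {m j : ℕ} (hj : m ≤ j) (A : β → ℕ → ℝ) (a : β)
    (h : List ℕ → ℝ) (w : List β) : act (j + 1) (addColumn m A a j 0) h w = act m A h w := by
  induction w generalizing h with
  | nil => rfl
  | cons b w ih => simp only [act, sum_range_addColumn hj, ih]; simp

theorem hasDerivAt_act_addColumn [DecidableEq β] {m j : ℕ} (hj : m ≤ j) (A : β → ℕ → ℝ) (a : β)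
    (h : List ℕ → ℝ) (w : List β) :
    HasDerivAt (fun s => act (j + 1) (addColumn m A a j s) h w) (actLinear m A a j h w) 0 := by
  induction w generalizing h with
  | nil => exact hasDerivAt_const _ _
  | cons b w ih =>
    simp only [act, sum_range_addColumn hj, actLinear]
    refine HasDerivAt.add ?_ (HasDerivAt.fun_sum fun i _ => (ih _).const_mul _)
    split_ifs
    -- Product rule at `s = 0`: the factor `s` removes the derivative of the remaining word, so the
    -- new column is used only once.
    · simpa [act_addColumn_zero hj] using (hasDerivAt_id' (0 : ℝ)).fun_mul (ih (fun u => h (j :: u)))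
    · exact hasDerivAt_const _ _

/-- A letter `j` in a word becomes negligible as `j → ∞` if it is the last one, and kills the
word otherwise. -/
def IsDegenerating (τ τ' : List ℕ → ℝ) : Prop :=
  ∀ u v : List ℕ, Tendsto (fun j => τ (u ++ j :: v)) atTop (𝓝 (if v = [] then τ' u else 0))

theorem tendsto_act_cons {τ τ' : List ℕ → ℝ} (hτ : ∀ v : List ℕ,
    Tendsto (fun j => τ (j :: v)) atTop (𝓝 (if v = [] then τ' [] else 0))) (m : ℕ)
    (A : β → ℕ → ℝ) (w : List β) : Tendsto (fun j => act m A (fun u => τ (j :: u)) w) atTop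
      (𝓝 (if w = [] then τ' [] else 0)) := by
  have H : ∀ (σ : ℕ → List ℕ → ℝ) (w : List β), (∀ v, Tendsto (fun j => σ j v) atTop (𝓝 0)) →
      Tendsto (fun j => act m A (σ j) w) atTop (𝓝 0) := by
    intro σ w
    induction w generalizing σ with
    | nil => intro h; exact h []
    | cons b w ih =>
      intro h
      have := tendsto_finsetSum (range m) fun i _ =>
        (ih (fun j u => σ j (i :: u)) fun v => h _).const_mul (A b i)
      simpa [act] using this
  cases w with
  | nil => exact hτ []
  | cons b w =>
    have := tendsto_finsetSum (range m) fun i _ =>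
        (H (fun j u => τ (j :: i :: u)) w fun v => by simpa using hτ (i :: v)).const_mul (A b i)
    simpa [act] using this

/-- Of the places where the new letter `j` can stand, only the last one survives in the limit. -/
theorem tendsto_actLinear [DecidableEq β] {τ τ' : List ℕ → ℝ} (hτ : IsDegenerating τ τ') (m : ℕ)
    (A : β → ℕ → ℝ) (a : β) (w : List β) :
    Tendsto (fun j => actLinear m A a j τ w) atTop (𝓝 (actRight m A a τ' w)) := by
  induction w generalizing τ τ' with
  | nil => exact tendsto_const_nhds
  | cons b w ih =>
    simp only [actLinear, actRight]
    refine Tendsto.add ?_ (tendsto_finsetSum _ fun i _ =>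
      (ih (τ' := fun u => τ' (i :: u)) fun u v => hτ (i :: u) v).const_mul _)
    by_cases hb : b = a
    · simpa [hb] using tendsto_act_cons (fun v => hτ [] v) m A w
    · simp [hb]

/-- Induction on a bound for the lengths of the words. For each letter `a`, the coefficients of the
words `u ++ [a]`, read as coefficients of `u`, satisfy the same hypothesis with a smaller bound. -/
theorem eq_zero_of_sum_act_eq_zero {τ : List ℕ → ℝ} (h1 : τ [] = 1)
    (hτ : IsDegenerating τ τ) {c : List β →₀ ℝ}
    (hc : ∀ (m : ℕ) (A : β → ℕ → ℝ), (c.sum fun w x => x * act m A τ w) = 0) : c = 0 := by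
  classical
  suffices H : ∀ (n : ℕ) (c : List β →₀ ℝ), (∀ w ∈ c.support, w.length < n) →
      (∀ (m : ℕ) (A : β → ℕ → ℝ), (c.sum fun w x => x * act m A τ w) = 0) → c = 0 by
    refine H (c.support.sup List.length + 1) c (fun w hw => ?_) hc
    exact Nat.lt_succ_of_le (Finset.le_sup (f := List.length) hw)
  intro n
  induction n with
  | zero =>
    intro c hn _
    rw [← Finsupp.support_eq_empty, Finset.eq_empty_iff_forall_notMem]
    intro w hw
    exact absurd (hn w hw) (by simp)
  | succ n ih =>
    intro c hn hc
    have inj : ∀ a : β, Function.Injective fun u : List β => u ++ [a] :=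
      fun a => List.append_left_injective [a]
    have key : ∀ a : β, c.comapDomain (fun u => u ++ [a]) (inj a).injOn = 0 := by
      intro a
      apply ih
      · intro w hw
        have := hn (w ++ [a]) (by simpa using hw)
        simpa using this
      · intro m A
        -- This is the derivative at `s = 0` of a function of the extra column that vanishes
        -- identically.
        have e1 : ∀ᶠ j in atTop, (c.sum fun w x => x * actLinear m A a j τ w) = 0 := by
          filter_upwards [eventually_ge_atTop m] with j hj
          have d1 : HasDerivAt (fun s => c.sum fun w x =>
              x * act (j + 1) (addColumn m A a j s) τ w)
              (c.sum fun w x => x * actLinear m A a j τ w) 0 :=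
            HasDerivAt.fun_sum fun w _ => (hasDerivAt_act_addColumn hj A a τ w).const_mul _
          simp only [hc] at d1
          exact d1.unique (hasDerivAt_const _ _)
        have e2 : Tendsto (fun j => c.sum fun w x => x * actLinear m A a j τ w) atTop
            (𝓝 (c.sum fun w x => x * actRight m A a τ w)) :=
          tendsto_finsetSum _ fun w _ => (tendsto_actLinear hτ m A a w).const_mul _
        have e3 : (c.sum fun w x => x * actRight m A a τ w) = 0 :=
          tendsto_nhds_unique e2 ((tendsto_congr' e1).2 tendsto_const_nhds)
        rw [← e3, Finsupp.sum, Finsupp.sum, Finsupp.comapDomain_support]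
        have e4 : ∀ u, (c.comapDomain (fun u => u ++ [a]) (inj a).injOn) u * act m A τ u =
            c (u ++ [a]) * actRight m A a τ (u ++ [a]) := by
          intro u
          simp [actRight_append_singleton]
        simp only [e4]
        refine Finset.sum_preimage (fun u => u ++ [a]) c.support (inj a).injOn
          (fun w => c w * actRight m A a τ w) ?_
        intro w _ hw
        rcases List.eq_nil_or_concat w with rfl | ⟨u, b, rfl⟩
        · simp [actRight]
        · rw [List.concat_eq_append] at hw ⊢
          rw [actRight_append_singleton, if_neg, mul_zero]
          rintro rfl
          exact hw ⟨u, rfl⟩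
    have hne : ∀ w, w ≠ [] → c w = 0 := by
      intro w hw
      rcases List.eq_nil_or_concat w with rfl | ⟨u, b, rfl⟩
      · exact absurd rfl hw
      · simpa using DFunLike.congr_fun (key b) u
    -- Only the empty word is left; its coefficient is read off with no columns, as `τ [] = 1`.
    have h0 := hc 0 0
    have hs : c = Finsupp.single [] (c []) := by
      ext w
      by_cases hw : w = []
      · subst hw; simp
      · rw [hne w hw, Finsupp.single_eq_of_ne hw]
    rw [hs] at h0
    rw [Finsupp.sum_single_index (by simp)] at h0
    simp only [act, h1, mul_one] at h0
    rw [hs, h0, Finsupp.single_zero]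

end Nondegenerate

/-! ### Points of projective space -/

section Projective

variable {K ι : Type*} [Field K]

theorem eval_smul_of_isHomogeneous {f : MvPolynomial ι K} {n : ℕ} (hf : f.IsHomogeneous n) (a : K)
    (v : ι → K) : MvPolynomial.eval (a • v) f = a ^ n * MvPolynomial.eval v f := by
  rw [MvPolynomial.eval_eq, MvPolynomial.eval_eq, Finset.mul_sum]
  refine Finset.sum_congr rfl fun m hm => ?_
  have hdeg : ∑ i ∈ m.support, m i = n := by
    have := hf (MvPolynomial.mem_support_iff.1 hm)
    simpa [Finsupp.weight_apply, Finsupp.sum] using this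
  simp only [Pi.smul_apply, smul_eq_mul, mul_pow, Finset.prod_mul_distrib]
  rw [Finset.prod_pow_eq_pow_sum, hdeg]
  ring

theorem eval_rep_mk_eq_zero_iff {f : MvPolynomial ι K} {n : ℕ} (hf : f.IsHomogeneous n)
    {v : ι → K} (hv : v ≠ 0) :
    MvPolynomial.eval (Projectivization.mk K v hv).rep f = 0 ↔ MvPolynomial.eval v f = 0 := by
  obtain ⟨a, ha⟩ := Projectivization.exists_smul_eq_mk_rep K v hv
  rw [← ha, Units.smul_def, eval_smul_of_isHomogeneous hf]
  simp

theorem subset_zariskiClosure (S : Set (Projectivization K (ι → K))) : S ⊆ zariskiClosure S :=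
  fun p hp _ hf _ => hf p hp

theorem zariskiClosure_mono {S T : Set (Projectivization K (ι → K))} (h : S ⊆ T) :
    zariskiClosure S ⊆ zariskiClosure T :=
  fun _ hp f hf hn => hp f (fun q hq => hf q (h hq)) hn

theorem zariskiClosure_subset_projZeros {S : Set (Projectivization K (ι → K))}
    {F : Set (MvPolynomial ι K)} (h : S ⊆ projZeros F) : zariskiClosure S ⊆ projZeros F := by
  intro p hp f hf hn
  exact hp f (fun q hq => h hq f hf hn) hn

theorem lines_subset_projZeros {S : Set (ι → K)} {F : Set (MvPolynomial ι K)}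
    (h : ∀ v ∈ S, ∀ f ∈ F, MvPolynomial.eval v f = 0) : lines S ⊆ projZeros F := by
  rintro p ⟨v, hv, h0, rfl⟩ f hf ⟨n, hn⟩
  rw [eval_rep_mk_eq_zero_iff hn h0]
  exact h v hv f hf

theorem lines_mono {S T : Set (ι → K)} (h : S ⊆ T) : lines (K := K) S ⊆ lines T :=
  fun _ ⟨v, hv, hp⟩ => ⟨v, h hv, hp⟩

end Projective

/-! ### Linearization of polynomials on characters -/

section Linearization

/-- As functions on the set of characters, the evaluations at words span a subspace closed under
multiplication, because a product of two evaluations is the sum over the shuffles. -/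
theorem exists_linearization {α K : Type*} [Field K] {k : ℕ}
    (f : MvPolynomial (Fin k → α) K) : ∃ c : List α →₀ K, ∀ g : List α → K, IsCharacter g →
      MvPolynomial.eval (fun w => g (List.ofFn w)) f = c.sum fun w x => x * g w := by
  let ev : List α → ({g : List α → K // IsCharacter g} → K) := fun w g => g.1 w
  let E := Submodule.span K (Set.range ev)
  have hmul : ∀ F ∈ E, ∀ w, F * ev w ∈ E := by
    intro F hF w
    induction hF using Submodule.span_induction with
    | mem F hF =>
      obtain ⟨u, rfl⟩ := hF
      have : ev u * ev w = ((shuffle u w).map ev).sum := by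
        funext g
        have := g.2.shuffle u w
        rw [shuffleSum] at this
        rw [Pi.mul_apply, ← this, Pi.list_sum_apply, List.map_map]
        rfl
      rw [this]
      refine list_sum_mem fun G hG => ?_
      obtain ⟨x, _, rfl⟩ := List.mem_map.1 hG
      exact Submodule.subset_span ⟨x, rfl⟩
    | zero => simp
    | add F G _ _ hF hG => rw [add_mul]; exact add_mem hF hG
    | smul a F _ hF => rw [smul_mul_assoc]; exact Submodule.smul_mem _ a hF
  have hE : (fun g : {g : List α → K // IsCharacter g} =>
      MvPolynomial.eval (fun w => g.1 (List.ofFn w)) f) ∈ E := by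
    induction f using MvPolynomial.induction_on with
    | C a =>
      have : (fun g : {g : List α → K // IsCharacter g} =>
          MvPolynomial.eval (fun w : Fin k → α => g.1 (List.ofFn w)) (MvPolynomial.C a)) =
          a • ev [] := by
        funext g
        simp [ev, g.2.nil]
      rw [this]
      exact Submodule.smul_mem _ a (Submodule.subset_span ⟨[], rfl⟩)
    | add p q hp hq => simp only [map_add]; exact add_mem hp hq
    | mul_X p w hp => simp only [map_mul, MvPolynomial.eval_X]; exact hmul _ hp (List.ofFn w)
  obtain ⟨c, hc⟩ := Finsupp.mem_span_range_iff_exists_finsupp.1 hE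
  refine ⟨c, fun g hg => ?_⟩
  rw [← congrFun hc ⟨g, hg⟩, Finsupp.sum, Finsupp.sum, Finset.sum_apply]
  rfl

end Linearization

theorem eval_aeval {K ι κ : Type*} [Field K] (x : κ → K) (F : ι → MvPolynomial κ K)
    (f : MvPolynomial ι K) : MvPolynomial.eval x (MvPolynomial.aeval (R := K) F f) =
      MvPolynomial.eval (fun i => MvPolynomial.eval x (F i)) f := by
  induction f using MvPolynomial.induction_on with
  | C a => simp
  | add p q hp hq => rw [map_add, map_add, map_add, hp, hq]
  | mul_X p i hp => rw [map_mul, map_mul, map_mul, hp, MvPolynomial.aeval_X, MvPolynomial.eval_X]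

/-! ### Characters as points of the universal variety -/

section Universal

variable {K : Type*} [Field K]

theorem eval_groupIdeal_eq_zero {d k : ℕ} {g : List (Fin d) → K} (hg : IsCharacter g)
    {f : MvPolynomial (Word d k) K} (hf : f ∈ groupIdeal K d k) :
    MvPolynomial.eval (fun w => g w.1) f = 0 := by
  have hcoord : ∀ w : List (Fin d), w.length ≤ k →
      MvPolynomial.eval (fun w : Word d k => g w.1) (coord K k w) = g w := by
    intro w hw
    rcases eq_or_ne w [] with rfl | h
    · simp [coord, hg.nil]
    · have : 1 ≤ w.length := List.length_pos_of_ne_nil h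
      simp [coord, this, hw]
  suffices groupIdeal K d k ≤ RingHom.ker (MvPolynomial.eval (fun w : Word d k => g w.1)) from
    this hf
  rw [groupIdeal, Ideal.span_le]
  rintro f ⟨I, J, hI, hJ, hIJ, rfl⟩
  simp only [SetLike.mem_coe, RingHom.mem_ker, map_sub, map_mul]
  rw [hcoord I (by omega), hcoord J (by omega), ← hg.shuffle, sub_eq_zero, shuffleSum, shuffleForm,
    map_list_sum, List.map_map]
  congr 1
  refine List.map_congr_left fun w hw => (hcoord w ?_).symm
  have := (perm_of_mem_shuffle I J w hw).length_eq
  simp at this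
  omega

theorem eval_universalIdeal_eq_zero {d k : ℕ} (hk : 1 ≤ k) {g : List (Fin d) → K}
    (hg : IsCharacter g) {f : MvPolynomial (Fin k → Fin d) K} (hf : f ∈ universalIdeal K d k) :
    MvPolynomial.eval (fun w => g (List.ofFn w)) f = 0 := by
  have h := eval_groupIdeal_eq_zero hg (Ideal.mem_comap.1 hf)
  rw [← h, AlgHom.toRingHom_eq_coe, RingHom.coe_coe, eval_aeval]
  congr 2
  funext w
  simp [coord, hk]

theorem shuffle_relations_of_mem_zeroLocus {d k : ℕ} {x : Word d k → K}
    (hx : x ∈ MvPolynomial.zeroLocus K (groupIdeal K d k)) :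
    ∀ I J : List (Fin d), I.length + J.length ≤ k →
      shuffleSum (fun w => MvPolynomial.eval x (coord K k w)) I J =
        MvPolynomial.eval x (coord K k I) * MvPolynomial.eval x (coord K k J) := by
  intro I J hIJ
  -- Relations with an empty word are not among the generators; they hold because `coord` is `1`
  -- there.
  rcases eq_or_ne I [] with rfl | hI
  · simp [coord]
  rcases eq_or_ne J [] with rfl | hJ
  · simp [coord]
  have := hx (coord K k I * coord K k J - shuffleForm K k I J) (Ideal.subset_span
    ⟨I, J, List.length_pos_of_ne_nil hI, List.length_pos_of_ne_nil hJ, hIJ, rfl⟩)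
  rw [MvPolynomial.aeval_eq_eval, map_sub, map_mul, sub_eq_zero] at this
  rw [this, shuffleSum, shuffleForm, map_list_sum, List.map_map]
  rfl

/-- A polynomial that vanishes on all characters has a power in the universal ideal. -/
theorem exists_pow_mem_universalIdeal [IsAlgClosed K] [CharZero K] {d k : ℕ}
    {f : MvPolynomial (Fin k → Fin d) K}
    (hf : ∀ g : List (Fin d) → K, IsCharacter g →
      MvPolynomial.eval (fun w => g (List.ofFn w)) f = 0) :
    ∃ N, f ^ N ∈ universalIdeal K d k := by
  have hfin : Finite (Word d k) := (List.finite_length_le (Fin d) k).subset (fun w hw => hw.2)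
  have : MvPolynomial.aeval (R := K) (fun w : Fin k → Fin d => coord K k (List.ofFn w)) f ∈
      (groupIdeal K d k).radical := by
    rw [← MvPolynomial.vanishingIdeal_zeroLocus_eq_radical (K := K), MvPolynomial.mem_vanishingIdeal_iff]
    intro x hx
    -- The point is only a truncated character; its extension is a full one, to which `hf` applies.
    obtain ⟨g, hg, hgx⟩ := exists_isCharacter_eq (by simp [coord])
      (shuffle_relations_of_mem_zeroLocus hx)
    rw [← hf g hg, MvPolynomial.aeval_eq_eval, eval_aeval]
    congr 2
    funext w
    rw [hgx _ (by simp)]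
  obtain ⟨N, hN⟩ := this
  exact ⟨N, by simpa [universalIdeal, Ideal.mem_comap] using hN⟩

end Universal

/-! ### Varieties of the tensors obtained from a character by matrices -/

section Variety

/-- The level-`k` tensor obtained from `h` by letting the matrix `A` act. -/
def sigPoint {R : Type*} [CommRing R] {d : ℕ} (h : List ℕ → R) (k m : ℕ) (A : Fin d → ℕ → R) :
    (Fin k → Fin d) → R :=
  fun w => act m A h (List.ofFn w)

/-- The Zariski closure of the set of the tensors that `d × m` matrices produce from `τ`. -/
def sigVariety (K : Type*) [Field K] [Algebra ℝ K] (τ : List ℕ → ℝ) (d k m : ℕ) :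
    Set (Projectivization K ((Fin k → Fin d) → K)) :=
  zariskiClosure (lines (Set.range fun A : Fin d → ℕ → K =>
    sigPoint (fun u => algebraMap ℝ K (τ u)) k m A))

theorem range_matrixAct {K : Type*} [Field K] [Algebra ℝ K] {τ : List ℕ → ℝ} {d k m : ℕ}
    {c : (Fin k → Fin m) → ℝ} (hc : ∀ u, c u = τ (List.ofFn fun l => (u l : ℕ))) :
    (Set.range fun A : Matrix (Fin d) (Fin m) K => matrixAct A c) =
      Set.range fun A : Fin d → ℕ → K => sigPoint (fun u => algebraMap ℝ K (τ u)) k m A := by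
  have key : ∀ (A : Matrix (Fin d) (Fin m) K) (B : Fin d → ℕ → K), (∀ a (i : Fin m),
      B a i = A a i) → matrixAct A c = sigPoint (fun u => algebraMap ℝ K (τ u)) k m B := by
    intro A B hAB
    funext w
    simp [matrixAct, sigPoint, act_ofFn, hAB, hc]
  ext x
  constructor
  · rintro ⟨A, rfl⟩
    refine ⟨fun a i => if h : i < m then A a ⟨i, h⟩ else 0, (key A _ ?_).symm⟩
    simp
  · rintro ⟨B, rfl⟩
    exact ⟨fun a i => B a i, key _ B fun _ _ => rfl⟩

theorem sigVariety_subset_succ (K : Type*) [Field K] [Algebra ℝ K] (τ : List ℕ → ℝ) (d k m : ℕ) :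
    sigVariety K τ d k m ⊆ sigVariety K τ d k (m + 1) := by
  refine zariskiClosure_mono (lines_mono ?_)
  rintro _ ⟨A, rfl⟩
  -- Column `m` of `A` is invisible to `act m` but not to `act (m + 1)`, so it is cleared.
  refine ⟨fun a i => if i < m then A a i else 0, ?_⟩
  funext w
  simp only [sigPoint]
  rw [act_succ_of_eq_zero (by simp)]
  exact act_congr_matrix (fun a i hi => by simp [hi]) _ _

theorem sigVariety_subset_universalVariety {K : Type*} [Field K] [Algebra ℝ K] {τ : List ℕ → ℝ}
    (hτ : IsCharacter τ) (d : ℕ) {k : ℕ} (hk : 1 ≤ k) (m : ℕ) :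
    sigVariety K τ d k m ⊆ universalVariety K d k := by
  refine zariskiClosure_subset_projZeros (lines_subset_projZeros ?_)
  rintro _ ⟨A, rfl⟩ f hf
  exact eval_universalIdeal_eq_zero hk ((hτ.map (algebraMap ℝ K)).act m A) hf

theorem act_one {β R : Type*} [CommRing R] (A : β → ℕ → R) (h : List ℕ → R) (w : List β) :
    act 1 A h w = (w.map fun a => A a 0).prod * h (List.replicate w.length 0) := by
  induction w generalizing h with
  | nil => simp [act]
  | cons a w ih => simp [act, ih, List.replicate_succ, mul_assoc]

theorem act_of_eq_zero {β R : Type*} [CommRing R] {A : β → ℕ → R} (hA : ∀ a i, 1 ≤ i → A a i = 0)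
    (h : List ℕ → R) (w : List β) {m : ℕ} (hm : 1 ≤ m) : act m A h w = act 1 A h w := by
  induction m, hm using Nat.le_induction with
  | base => rfl
  | succ m hm ih => rw [act_succ_of_eq_zero (fun a => hA a m hm), ih]

/-- Shuffling a letter into `n` copies of itself gives `n + 1` equal words, so the `n`-th shuffle
power of a letter is `n!` times its repetition. -/
theorem IsCharacter.replicate {τ : List ℕ → ℝ} (hτ : IsCharacter τ) (a : ℕ) (n : ℕ) :
    n.factorial * τ (List.replicate n a) = τ [a] ^ n := by
  have key : ∀ (n : ℕ) (h : List ℕ → ℝ), shuffleSum h [a] (List.replicate n a) =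
      (n + 1) * h (List.replicate (n + 1) a) := by
    intro n
    induction n with
    | zero => intro h; simp
    | succ n ih =>
      intro h
      rw [List.replicate_succ, shuffleSum_cons, shuffleSum_nil_left, ih]
      simp only [List.replicate_succ]
      push_cast
      ring
  induction n with
  | zero => simp [hτ.nil]
  | succ n ih =>
    rw [pow_succ, ← ih, mul_assoc, mul_comm _ (τ [a]), ← hτ.shuffle, key, Nat.factorial_succ]
    push_cast
    ring

theorem IsCharacter.replicate_ne_zero {τ : List ℕ → ℝ} (hτ : IsCharacter τ) {a : ℕ}
    (ha : τ [a] ≠ 0) (n : ℕ) : τ (List.replicate n a) ≠ 0 := by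
  intro h
  have := hτ.replicate a n
  rw [h, mul_zero] at this
  exact pow_ne_zero n ha this.symm

theorem lines_sigPoint_one {K : Type*} [Field K] [Algebra ℝ K] {τ : List ℕ → ℝ}
    (hτ : IsCharacter τ) (h0 : τ [0] ≠ 0) (d k : ℕ) :
    lines (Set.range fun A : Fin d → ℕ → K => sigPoint (fun u => algebraMap ℝ K (τ u)) k 1 A) =
      veronese K d k := by
  obtain ⟨c, hc⟩ : ∃ c, c = algebraMap ℝ K (τ (List.replicate k 0)) := ⟨_, rfl⟩
  have hc0 : c ≠ 0 := by
    rw [hc]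
    simpa using hτ.replicate_ne_zero h0 k
  have key : ∀ A : Fin d → ℕ → K, sigPoint (fun u => algebraMap ℝ K (τ u)) k 1 A =
      c • fun w => ∏ l, A (w l) 0 := by
    intro A
    funext w
    simp [sigPoint, act_one, hc, List.prod_ofFn, mul_comm, Function.comp_def]
  ext p
  constructor
  · rintro ⟨_, ⟨A, rfl⟩, hv, rfl⟩
    have hv' : (fun w : Fin k → Fin d => ∏ l, A (w l) 0) ≠ 0 := by
      rintro h
      apply hv
      simp only [key, h, smul_zero]
    refine ⟨_, ⟨fun a => A a 0, rfl⟩, hv', ?_⟩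
    rw [Projectivization.mk_eq_mk_iff']
    exact ⟨c, (key A).symm⟩
  · rintro ⟨_, ⟨v, rfl⟩, hv, rfl⟩
    refine ⟨_, ⟨fun a _ => v a, rfl⟩, ?_, ?_⟩
    · simp only [key]
      exact smul_ne_zero hc0 hv
    · rw [Projectivization.mk_eq_mk_iff']
      refine ⟨c⁻¹, ?_⟩
      simp only [key, smul_smul, inv_mul_cancel₀ hc0, one_smul]

/-! ### The Veronese variety is closed -/

/-- Two families of equations suffice. The relations `x_w^k = ∏ x_{w_l⋯w_l}` yield a nonzero
diagonal coordinate `x_{a⋯a}`, and `x_{a⋯a}^{k-1} x_w = ∏ x_{w_l a⋯a}` then exhibits `x`, up to a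
scalar, as `v^{⊗k}` with `v_b = x_{b a⋯a}`. -/
theorem veronese_eq_zariskiClosure (K : Type*) [Field K] (d : ℕ) {k : ℕ} (hk : 1 ≤ k) :
    zariskiClosure (veronese K d k) = veronese K d k := by
  refine Set.Subset.antisymm (fun p hp => ?_) (subset_zariskiClosure _)
  obtain ⟨x, hx⟩ : ∃ x, x = p.rep := ⟨_, rfl⟩
  have hx0 : x ≠ 0 := hx ▸ p.rep_nonzero
  have van : ∀ (f : MvPolynomial (Fin k → Fin d) K) (n : ℕ), f.IsHomogeneous n →
      (∀ v : Fin d → K, MvPolynomial.eval (fun w => ∏ l, v (w l)) f = 0) →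
      MvPolynomial.eval x f = 0 := by
    intro f n hn hf
    rw [hx]
    refine hp f ?_ ⟨n, hn⟩
    rintro _ ⟨_, ⟨v, rfl⟩, hv, rfl⟩
    exact (eval_rep_mk_eq_zero_iff hn hv).2 (hf v)
  have hprod : ∀ F : Fin k → (Fin k → Fin d),
      (∏ l, (MvPolynomial.X (F l) : MvPolynomial (Fin k → Fin d) K)).IsHomogeneous k := by
    intro F
    simpa using MvPolynomial.IsHomogeneous.prod Finset.univ _ (fun _ => 1)
      fun l _ => MvPolynomial.isHomogeneous_X K (F l)
  obtain ⟨w₀, hw₀⟩ := Function.ne_iff.1 hx0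
  have r1 : ∀ w, x w ^ k = ∏ l, x (fun _ => w l) := by
    intro w
    have := van (MvPolynomial.X w ^ k - ∏ l, MvPolynomial.X (fun _ => w l)) k
      (MvPolynomial.IsHomogeneous.sub (by simpa using hprod fun _ => w) (hprod _))
      (fun v => by simp [map_prod, Finset.prod_pow])
    simpa [map_prod, sub_eq_zero] using this
  let l₀ : Fin k := ⟨0, hk⟩
  obtain ⟨a, ha⟩ : ∃ a, a = w₀ l₀ := ⟨_, rfl⟩
  have hxa : x (fun _ => a) ≠ 0 := by
    have h := pow_ne_zero k hw₀
    rw [r1 w₀] at h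
    rw [ha]
    exact Finset.prod_ne_zero_iff.1 h l₀ (Finset.mem_univ _)
  have r2 : ∀ w, x (fun _ => a) ^ (k - 1) * x w =
      ∏ l, x (Function.update (fun _ => a) l₀ (w l)) := by
    intro w
    have := van (MvPolynomial.X (fun _ => a) ^ (k - 1) * MvPolynomial.X w -
      ∏ l, MvPolynomial.X (Function.update (fun _ => a) l₀ (w l))) k
      (MvPolynomial.IsHomogeneous.sub (by
        have := ((MvPolynomial.isHomogeneous_X K (fun _ : Fin k => a)).pow (k - 1)).mul
          (MvPolynomial.isHomogeneous_X K w)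
        rwa [one_mul, Nat.sub_add_cancel hk] at this) (hprod _))
      (fun v => by
        have hup : ∀ b : Fin d, ∏ l, v ((Function.update (fun _ => a) l₀ b : Fin k → Fin d) l) =
            v b * v a ^ (k - 1) := by
          intro b
          rw [← Finset.mul_prod_erase Finset.univ _ (Finset.mem_univ l₀)]
          rw [Function.update_self, Finset.prod_congr rfl (g := fun _ => v a) fun l hl => by
            rw [Function.update_of_ne (Finset.ne_of_mem_erase hl)]]
          simp
        simp only [map_sub, map_mul, map_pow, map_prod, MvPolynomial.eval_X, hup,
          Finset.prod_mul_distrib, Finset.prod_const, Finset.card_univ, Fintype.card_fin]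
        ring)
    simpa [map_prod, sub_eq_zero] using this
  have hv : x (fun _ => a) ^ (k - 1) • x =
      fun w => ∏ l, x (Function.update (fun _ => a) l₀ (w l)) := by
    funext w
    exact r2 w
  have hc := pow_ne_zero (k - 1) hxa
  refine ⟨_, ⟨fun b => x (Function.update (fun _ => a) l₀ b), rfl⟩, ?_, ?_⟩
  · simp only [← hv]
    exact smul_ne_zero hc hx0
  · rw [← p.mk_rep, Projectivization.mk_eq_mk_iff']
    refine ⟨(x (fun _ => a) ^ (k - 1))⁻¹, ?_⟩
    rw [← hx]
    exact (congrArg _ hv.symm).trans (by rw [smul_smul, inv_mul_cancel₀ hc, one_smul])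

/-! ### Stabilization -/

/-- The real polynomials that vanish on all tensors produced from `τ` by `d × m` matrices. -/
noncomputable def sigIdeal (τ : List ℕ → ℝ) (d k m : ℕ) : Ideal (MvPolynomial (Fin k → Fin d) ℝ) :=
  RingHom.ker (MvPolynomial.aeval (R := ℝ) (S₁ := MvPolynomial (Fin d × ℕ) ℝ)
    (sigPoint (fun u => MvPolynomial.C (τ u)) k m fun a i => MvPolynomial.X (a, i))).toRingHom

instance (τ : List ℕ → ℝ) (d k m : ℕ) : (sigIdeal τ d k m).IsPrime := RingHom.ker_isPrime _

/-- The kernel at the generic matrix is visibly prime; since ℝ is infinite, it is also the ideal of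
vanishing at all real matrices. -/
theorem mem_sigIdeal_iff {τ : List ℕ → ℝ} {d k m : ℕ} {f : MvPolynomial (Fin k → Fin d) ℝ} :
    f ∈ sigIdeal τ d k m ↔ ∀ A : Fin d → ℕ → ℝ, MvPolynomial.eval (sigPoint τ k m A) f = 0 := by
  have key : ∀ x : Fin d × ℕ → ℝ, MvPolynomial.eval x (MvPolynomial.aeval (R := ℝ)
      (sigPoint (fun u => MvPolynomial.C (τ u)) k m fun a i => MvPolynomial.X (a, i)) f) =
      MvPolynomial.eval (sigPoint τ k m fun a i => x (a, i)) f := by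
    intro x
    rw [eval_aeval]
    congr 2
    funext w
    simp only [sigPoint]
    rw [← map_act]
    simp
  rw [sigIdeal, RingHom.mem_ker, AlgHom.toRingHom_eq_coe, RingHom.coe_coe]
  constructor
  · intro h A
    have := key fun x => A x.1 x.2
    rw [h, map_zero] at this
    exact this.symm
  · intro h
    refine MvPolynomial.funext fun x => ?_
    rw [key, h, map_zero]

theorem sigIdeal_antitone (τ : List ℕ → ℝ) (d k : ℕ) : Antitone (sigIdeal τ d k) := by
  refine antitone_nat_of_succ_le fun m f hf => ?_
  rw [mem_sigIdeal_iff] at hf ⊢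
  intro A
  rw [← hf fun a i => if i < m then A a i else 0]
  congr 2
  funext w
  simp only [sigPoint]
  rw [act_succ_of_eq_zero (by simp)]
  exact act_congr_matrix (fun a i hi => by simp [hi]) _ _

/-- Descending chains of ideals need not stabilize, but these are primes: past an index of least
height, nested primes of equal height coincide. -/
theorem exists_sigIdeal_eq (τ : List ℕ → ℝ) (d k : ℕ) :
    ∃ M, ∀ m, M ≤ m → sigIdeal τ d k m = sigIdeal τ d k M := by
  obtain ⟨_, ⟨M, rfl⟩, hM⟩ := wellFounded_lt.has_min
    (Set.range fun m => (sigIdeal τ d k m).height) (Set.range_nonempty _)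
  exact ⟨M, fun m hm => Ideal.eq_of_le_of_height_le _ (sigIdeal_antitone τ d k hm)
    (not_lt.1 (hM (sigIdeal τ d k m).height ⟨m, rfl⟩))⟩

/-- A polynomial over `K` that vanishes at the real points for one large number of columns
vanishes at the real points for all numbers of columns. -/
theorem eval_map_sigPoint_eq_zero {K : Type*} [Field K] [Algebra ℝ K] {τ : List ℕ → ℝ}
    {d k m n : ℕ} (hmn : sigIdeal τ d k m ≤ sigIdeal τ d k n)
    {f : MvPolynomial (Fin k → Fin d) K}
    (hf : ∀ A : Fin d → ℕ → ℝ,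
      MvPolynomial.eval (fun w => algebraMap ℝ K (sigPoint τ k m A w)) f = 0)
    (A : Fin d → ℕ → ℝ) :
    MvPolynomial.eval (fun w => algebraMap ℝ K (sigPoint τ k n A w)) f = 0 := by
  -- Functionals `K → ℝ` separate the elements of `K`; applied to the coefficients of `f`, they give
  -- real polynomials with the corresponding values at real points.
  rw [← Module.forall_dual_apply_eq_zero_iff ℝ]
  intro φ
  let fφ : MvPolynomial (Fin k → Fin d) ℝ :=
    ∑ s ∈ f.support, MvPolynomial.monomial s (φ (f.coeff s))
  have key : ∀ x : (Fin k → Fin d) → ℝ,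
      φ (MvPolynomial.eval (fun w => algebraMap ℝ K (x w)) f) = MvPolynomial.eval x fφ := by
    intro x
    simp only [fφ, map_sum, MvPolynomial.eval_monomial, Finsupp.prod]
    rw [MvPolynomial.eval_eq, map_sum]
    refine Finset.sum_congr rfl fun s _ => ?_
    simp only [← map_pow, ← map_prod]
    rw [mul_comm, ← Algebra.smul_def, map_smul, smul_eq_mul, mul_comm]
  rw [key]
  refine mem_sigIdeal_iff.1 (hmn (mem_sigIdeal_iff.2 fun B => ?_)) A
  rw [← key, hf, map_zero]

theorem eval_isCharacter_eq_zero {K : Type*} [Field K] [Algebra ℝ K] {τ : List ℕ → ℝ}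
    (hτ : IsCharacter τ) (hdeg : IsDegenerating τ τ) {d k : ℕ}
    {f : MvPolynomial (Fin k → Fin d) K}
    (hf : ∀ (m : ℕ) (A : Fin d → ℕ → ℝ),
      MvPolynomial.eval (fun w => algebraMap ℝ K (sigPoint τ k m A w)) f = 0)
    {g : List (Fin d) → K} (hg : IsCharacter g) :
    MvPolynomial.eval (fun w => g (List.ofFn w)) f = 0 := by
  obtain ⟨c, hc⟩ := exists_linearization f
  suffices c = 0 by rw [hc g hg, this, Finsupp.sum_zero_index]
  ext w
  rw [Finsupp.zero_apply, ← Module.forall_dual_apply_eq_zero_iff ℝ]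
  intro φ
  -- Nondegeneracy is a real statement, so it is applied to the image of `c` under each functional.
  have h0 : c.mapRange φ φ.map_zero = 0 := by
    refine eq_zero_of_sum_act_eq_zero hτ.nil hdeg fun m A => ?_
    have h := hc _ ((hτ.act m A).map (algebraMap ℝ K))
    rw [show (fun w : Fin k → Fin d => algebraMap ℝ K (act m A τ (List.ofFn w))) =
      fun w => algebraMap ℝ K (sigPoint τ k m A w) from rfl, hf m A] at h
    rw [Finsupp.sum_mapRange_index (by simp)]
    have h' := congrArg φ h
    rw [map_zero, Finsupp.sum, map_sum] at h'
    rw [h', Finsupp.sum]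
    refine Finset.sum_congr rfl fun w _ => ?_
    rw [mul_comm (c w), ← Algebra.smul_def, map_smul, smul_eq_mul, mul_comm]
  simpa using DFunLike.congr_fun h0 w

theorem universalVariety_subset_sigVariety {K : Type*} [Field K] [IsAlgClosed K] [Algebra ℝ K]
    {τ : List ℕ → ℝ} (hτ : IsCharacter τ) (hdeg : IsDegenerating τ τ) (h0 : τ [0] ≠ 0)
    {d k m : ℕ} (hd : 1 ≤ d) (hm : 1 ≤ m) (hmn : ∀ n, sigIdeal τ d k m ≤ sigIdeal τ d k n) :
    universalVariety K d k ⊆ sigVariety K τ d k m := by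
  have : CharZero K := charZero_of_injective_algebraMap (algebraMap ℝ K).injective
  rintro p hp f hf ⟨n, hn⟩
  have hf' : ∀ A : Fin d → ℕ → K, sigPoint (fun u => algebraMap ℝ K (τ u)) k m A ≠ 0 →
      MvPolynomial.eval (sigPoint (fun u => algebraMap ℝ K (τ u)) k m A) f = 0 := fun A hA =>
    (eval_rep_mk_eq_zero_iff hn hA).1 (hf _ ⟨_, ⟨A, rfl⟩, hA, rfl⟩)
  -- Some matrices give the zero tensor, which is no projective point. Scaling a nonzero tensor on
  -- which `f` vanishes by `0` covers them, even when `f` has degree `0`.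
  have hf0 : MvPolynomial.eval 0 f = 0 := by
    let A : Fin d → ℕ → K := fun _ i => if i = 0 then 1 else 0
    have hA : sigPoint (fun u => algebraMap ℝ K (τ u)) k m A ≠ 0 := by
      refine Function.ne_iff.2 ⟨fun _ => ⟨0, hd⟩, ?_⟩
      rw [sigPoint, act_of_eq_zero (by simp +contextual [A, Nat.one_le_iff_ne_zero]) _ _ hm,
        act_one]
      simpa [A] using hτ.replicate_ne_zero h0 k
    have h1 := eval_smul_of_isHomogeneous hn 0 (sigPoint (fun u => algebraMap ℝ K (τ u)) k m A)
    rw [hf' A hA, zero_smul, mul_zero] at h1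
    exact h1
  have hreal : ∀ A : Fin d → ℕ → ℝ,
      MvPolynomial.eval (fun w => algebraMap ℝ K (sigPoint τ k m A w)) f = 0 := by
    intro A
    have e : (fun w => algebraMap ℝ K (sigPoint τ k m A w)) =
        sigPoint (fun u => algebraMap ℝ K (τ u)) k m fun a i => algebraMap ℝ K (A a i) := by
      funext w
      exact (map_act _ _ _ _ _).symm
    rw [e]
    by_cases h : sigPoint (fun u => algebraMap ℝ K (τ u)) k m
        (fun a i => algebraMap ℝ K (A a i)) = 0
    · rw [h, hf0]
    · exact hf' _ h
  obtain ⟨N, hN⟩ := exists_pow_mem_universalIdeal (f := f) fun g hg =>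
    eval_isCharacter_eq_zero hτ hdeg (fun l A => eval_map_sigPoint_eq_zero (hmn l) hreal A) hg
  have := hp _ hN ⟨_, hn.pow N⟩
  rw [map_pow] at this
  by_contra h
  exact pow_ne_zero N h this

theorem exists_chain (τ : List ℕ → ℝ) (hτ : IsCharacter τ) (hdeg : IsDegenerating τ τ)
    (h0 : τ [0] ≠ 0) {d k : ℕ} (hd : 1 ≤ d) (hk : 1 ≤ k) :
    ∃ M : ℕ, 1 ≤ M ∧ ∀ (K : Type*) [Field K] [IsAlgClosed K] [Algebra ℝ K],
      veronese K d k = sigVariety K τ d k 1 ∧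
      (∀ m : ℕ, 1 ≤ m → sigVariety K τ d k m ⊆ sigVariety K τ d k (m + 1)) ∧
      (∀ m : ℕ, M ≤ m → sigVariety K τ d k m = universalVariety K d k) := by
  obtain ⟨M, hM⟩ := exists_sigIdeal_eq τ d k
  -- The bound comes from real ideals alone, before `K` is chosen; adding one ensures at least one
  -- column.
  refine ⟨M + 1, by omega, fun K _ _ _ => ⟨?_, fun m _ => sigVariety_subset_succ K τ d k m,
    fun m hm => ?_⟩⟩
  · rw [sigVariety, lines_sigPoint_one hτ h0, veronese_eq_zariskiClosure K d hk]
  · refine (sigVariety_subset_universalVariety hτ d hk m).antisymm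
      (universalVariety_subset_sigVariety hτ hdeg h0 hd (by omega) fun n => ?_)
    rw [hM m (by omega)]
    rcases le_total M n with h | h
    · rw [hM n h]
    · exact sigIdeal_antitone τ d k h

end Variety

/-! ### Characters defined by a recursion on the last letter -/

section LastLetter

/-- The recursion is `∂g = g * p` with `p` supported on single letters, and no single letter is a
shuffle of two nonempty words. -/
theorem isCharacter_of_append_singleton {α : Type*} {g : List α → ℝ} {wt q : α → ℝ}
    (h1 : g [] = 1) (hg : ∀ w a, ((w ++ [a]).map wt).sum * g (w ++ [a]) = g w * q a)
    (hwt : ∀ a, 0 < wt a) : IsCharacter g := by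
  let p : List α → ℝ := fun w => if w.length = 1 then (w.map q).sum else 0
  have hp : IsPrimitive p := isPrimitive_of_length_ne_one fun w hw => by simp [p, hw]
  refine isCharacter_of_conv (wt := wt) h1 hp (fun w => ?_) fun w hw => ?_
  · rcases List.eq_nil_or_concat w with rfl | ⟨u, a, rfl⟩
    · simp [conv, hp.nil]
    · rw [List.concat_eq_append, conv_append_singleton, hp.nil, mul_zero, add_zero, hg, conv,
        splitSum_eq_single_nil_right]
      · simp [p]
      · intro x y _ hy
        simp [p, hy]
  · refine (List.sum_pos _ (fun x hx => ?_) (by simpa using hw)).ne'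
    obtain ⟨a, _, rfl⟩ := List.mem_map.1 hx
    exact hwt a

end LastLetter

/-! ### The axis path -/

section Axis

/-- The signature of a straight line in direction `s • e_i`. -/
noncomputable def expChar (i : ℕ) (s : ℝ) (w : List ℕ) : ℝ :=
  if ∀ a ∈ w, a = i then s ^ w.length / w.length.factorial else 0

@[simp] theorem expChar_nil (i : ℕ) (s : ℝ) : expChar i s [] = 1 := by simp [expChar]

theorem expChar_eq_zero {i a : ℕ} {w : List ℕ} (ha : a ∈ w) (hai : a ≠ i) (s : ℝ) :
    expChar i s w = 0 := if_neg fun h => hai (h a ha)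

theorem expChar_zero {w : List ℕ} (hw : w ≠ []) (i : ℕ) : expChar i 0 w = 0 := by
  simp [expChar, hw]

theorem expChar_append_singleton (i : ℕ) (s : ℝ) (w : List ℕ) (a : ℕ) :
    expChar i s (w ++ [a]) = if a = i then s / (w.length + 1) * expChar i s w else 0 := by
  by_cases ha : a = i
  · by_cases hw : ∀ b ∈ w, b = i
    · have h : ∀ b ∈ w ++ [a], b = i := by
        intro b hb
        rcases List.mem_append.1 hb with h | h
        · exact hw b h
        · rw [List.mem_singleton.1 h, ha]
      rw [if_pos ha, expChar, expChar, if_pos h, if_pos hw, List.length_append,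
        List.length_singleton, Nat.factorial_succ]
      push_cast
      field_simp
      ring
    · have h : ¬ ∀ b ∈ w ++ [a], b = i := fun h => hw fun b hb => h b (by simp [hb])
      rw [expChar, expChar, if_neg h, if_neg hw, mul_zero, ite_self]
  · rw [if_neg ha, expChar_eq_zero (a := a) (by simp) ha]

theorem isCharacter_expChar (i : ℕ) (s : ℝ) : IsCharacter (expChar i s) := by
  refine isCharacter_of_append_singleton (wt := fun _ => 1) (q := fun a => if a = i then s else 0)
    (by simp) (fun w a => ?_) fun _ => one_pos
  rw [sum_map_one, expChar_append_singleton]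
  split_ifs
  · simp only [List.length_append, List.length_singleton]
    push_cast
    field_simp
  · simp

/-- The signature of the path with steps `e_0, …, e_{n-1}`. -/
noncomputable def axisChar : ℕ → List ℕ → ℝ
  | 0 => expChar 0 0
  | n + 1 => conv (axisChar n) (expChar n 1)

theorem isCharacter_axisChar (n : ℕ) : IsCharacter (axisChar n) := by
  induction n with
  | zero => exact isCharacter_expChar 0 0
  | succ n ih => exact ih.conv (isCharacter_expChar n 1)

theorem axisChar_eq_zero {n a : ℕ} {w : List ℕ} (ha : a ∈ w) (hn : n ≤ a) : axisChar n w = 0 := by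
  induction n generalizing w with
  | zero => exact expChar_zero (List.ne_nil_of_mem ha) 0
  | succ n ih =>
    rw [axisChar, conv, splitSum_congr (G := fun _ _ => (0 : ℝ)) fun u v huv => ?_]
    · simp [splitSum]
    · rw [← huv, List.mem_append] at ha
      rcases ha with h | h
      · rw [ih h (by omega), zero_mul]
      · rw [expChar_eq_zero h (by omega), mul_zero]

theorem axisChar_succ_of_notMem {n : ℕ} {w : List ℕ} (hw : n ∉ w) :
    axisChar (n + 1) w = axisChar n w := by
  rw [axisChar, conv, splitSum_eq_single_nil_right]
  · simp
  · intro u v huv hv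
    obtain ⟨a, ha⟩ := List.exists_mem_of_ne_nil v hv
    rw [expChar_eq_zero ha, mul_zero]
    rintro rfl
    exact hw (huv ▸ List.mem_append_right u ha)

theorem axisChar_eq_of_le {n m : ℕ} (hnm : n ≤ m) {w : List ℕ} (hw : ∀ a ∈ w, a < n) :
    axisChar m w = axisChar n w := by
  induction m, hnm using Nat.le_induction with
  | base => rfl
  | succ m hm ih => rw [axisChar_succ_of_notMem fun h => (hw m h).not_ge hm, ih]

/-- The signature of the path with steps `e_0, e_1, …`. -/
noncomputable def axisLimit (w : List ℕ) : ℝ := axisChar (w.sum + 1) w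

/-- Steps in directions absent from a word do not affect its value, and `w.sum + 1` exceeds every
letter of `w`. -/
theorem axisLimit_eq {n : ℕ} {w : List ℕ} (hw : ∀ a ∈ w, a < n) :
    axisLimit w = axisChar n w := by
  have h : ∀ a ∈ w, a < w.sum + 1 := fun a ha => Nat.lt_succ_of_le (List.le_sum_of_mem ha)
  rcases le_total n (w.sum + 1) with h' | h'
  · exact axisChar_eq_of_le h' hw
  · exact (axisChar_eq_of_le h' h).symm

theorem isCharacter_axisLimit : IsCharacter axisLimit := by
  refine ⟨(isCharacter_axisChar _).nil, fun I J => ?_⟩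
  have h : ∀ a ∈ I ++ J, a < (I ++ J).sum + 1 := fun a ha =>
    Nat.lt_succ_of_le (List.le_sum_of_mem ha)
  rw [axisLimit_eq (w := I) fun a ha => h a (List.mem_append_left _ ha),
    axisLimit_eq (w := J) fun a ha => h a (List.mem_append_right _ ha),
    ← (isCharacter_axisChar _).shuffle]
  exact shuffleSum_congr fun w hw => axisLimit_eq fun a ha => h a (hw.mem_iff.1 ha)

theorem axisLimit_singleton_zero : axisLimit [0] = 1 := by
  rw [axisLimit_eq (n := 1) (by simp), axisChar, conv, splitSum_cons, splitSum_nil]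
  simp [axisChar, expChar]

/-- The sequence is eventually constant: once `j` exceeds the other letters, the step `e_j` comes
last, so `j` must end the word and then contributes a factor `1`. -/
theorem isDegenerating_axisLimit : IsDegenerating axisLimit axisLimit := by
  intro u v
  refine tendsto_nhds_of_eventually_eq ?_
  filter_upwards [eventually_ge_atTop ((u ++ v).sum + 1)] with j hj
  have h : ∀ a ∈ u ++ v, a < j := fun a ha =>
    lt_of_lt_of_le (Nat.lt_succ_of_le (List.le_sum_of_mem ha)) hj
  have hu : ∀ a ∈ u, a < j := fun a ha => h a (List.mem_append_left _ ha)
  have hv : ∀ a ∈ v, a < j := fun a ha => h a (List.mem_append_right _ ha)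
  rw [axisLimit_eq (n := j + 1), axisChar]
  · rcases List.eq_nil_or_concat v with rfl | ⟨x, b, rfl⟩
    · rw [if_pos rfl, conv_append_singleton, axisChar_eq_zero (a := j) (by simp) le_rfl, zero_mul,
        add_zero, conv, splitSum_eq_single_nil_right, axisLimit_eq hu]
      · simp [expChar]
      · intro y z hyz hz
        obtain ⟨a, ha⟩ := List.exists_mem_of_ne_nil z hz
        rw [expChar_eq_zero (a := a) (by simp [ha]), mul_zero]
        exact (hu a (hyz ▸ List.mem_append_right y ha)).ne
    · rw [List.concat_eq_append] at hv ⊢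
      rw [if_neg (by simp), ← List.cons_append, ← List.append_assoc, conv_append_singleton,
        axisChar_eq_zero (a := j) (by simp) le_rfl, zero_mul, add_zero, conv]
      have : ∀ z, expChar j 1 (z ++ [b]) = 0 := fun z =>
        expChar_eq_zero (a := b) (by simp) (hv b (by simp)).ne 1
      simp [this, splitSum]
  · intro a ha
    simp only [List.mem_append, List.mem_cons] at ha
    rcases ha with ha | rfl | ha
    · exact (hu a ha).trans (Nat.lt_succ_self j)
    · exact Nat.lt_succ_self _
    · exact (hv a ha).trans (Nat.lt_succ_self j)

theorem hasDerivAt_expChar_append_singleton (i : ℕ) (s : ℝ) (w : List ℕ) (a : ℕ) :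
    HasDerivAt (fun s => expChar i s (w ++ [a])) (if a = i then expChar i s w else 0) s := by
  simp only [expChar_append_singleton]
  split_ifs
  · by_cases hw : ∀ b ∈ w, b = i
    · simp only [expChar, if_pos hw]
      have h := ((hasDerivAt_pow (w.length + 1) s).div_const
        (((w.length : ℝ) + 1) * w.length.factorial))
      have e : (fun s : ℝ => s / ((w.length : ℝ) + 1) * (s ^ w.length / w.length.factorial)) =
          fun s => s ^ (w.length + 1) / (((w.length : ℝ) + 1) * w.length.factorial) := by
        funext s
        field_simp
        ring
      rw [e]
      refine h.congr_deriv ?_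
      rw [Nat.add_sub_cancel]
      push_cast
      field_simp
    · simp only [expChar, if_neg hw, mul_zero]
      exact hasDerivAt_const _ _
  · exact hasDerivAt_const _ _

theorem hasDerivAt_conv_expChar (g : List ℕ → ℝ) (i : ℕ) (s : ℝ) (w : List ℕ) (a : ℕ) :
    HasDerivAt (fun s => conv g (expChar i s) (w ++ [a]))
      (if a = i then conv g (expChar i s) w else 0) s := by
  have h : (fun s => conv g (expChar i s) (w ++ [a])) =
      fun s => (∑ j ∈ range (w.length + 1), g (w.take j) * expChar i s (w.drop j ++ [a])) +
        g (w ++ [a]) := by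
    funext s
    rw [conv_append_singleton, expChar_nil, mul_one]
    rfl
  have h' : (if a = i then conv g (expChar i s) w else 0) =
      (∑ j ∈ range (w.length + 1), g (w.take j) * if a = i then expChar i s (w.drop j) else 0) := by
    split_ifs
    · rfl
    · simp
  rw [h, h']
  exact (HasDerivAt.fun_sum fun j _ =>
    (hasDerivAt_expChar_append_singleton i s (w.drop j) a).const_mul _).add_const _

theorem continuous_conv_expChar (g : List ℕ → ℝ) (i : ℕ) (w : List ℕ) :
    Continuous fun s => conv g (expChar i s) w := by
  rcases List.eq_nil_or_concat w with rfl | ⟨u, a, rfl⟩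
  · simp only [conv, splitSum_nil, expChar_nil]
    exact continuous_const
  · rw [List.concat_eq_append]
    exact continuous_iff_continuousAt.2 fun s => (hasDerivAt_conv_expChar g i s u a).continuousAt

theorem conv_expChar_zero (g : List ℕ → ℝ) (i : ℕ) (w : List ℕ) : conv g (expChar i 0) w = g w := by
  rw [conv, splitSum_eq_single_nil_right]
  · simp
  · intro u v _ hv
    rw [expChar_zero hv, mul_zero]

theorem deriv_axisPath {m i : ℕ} (a : Fin m) {s : ℝ} (h1 : (i : ℝ) < m * s)
    (h2 : (m : ℝ) * s < i + 1) :
    deriv (fun u => axisPath m u a) s = if (a : ℕ) = i then (m : ℝ) else 0 := by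
  have hc : Continuous fun u : ℝ => (m : ℝ) * u := by fun_prop
  have ev : ∀ᶠ u in 𝓝 s, (i : ℝ) < m * u ∧ (m : ℝ) * u < i + 1 :=
    (hc.continuousAt.eventually (lt_mem_nhds h1)).and (hc.continuousAt.eventually (gt_mem_nhds h2))
  rcases lt_trichotomy (a : ℕ) i with h | h | h
  · have h' : (a : ℝ) + 1 ≤ i := by exact_mod_cast h
    rw [if_neg h.ne, Filter.EventuallyEq.deriv_eq (f := fun _ => (1 : ℝ)), deriv_const]
    filter_upwards [ev] with u hu
    rw [axisPath, min_eq_left (by linarith [hu.1]), max_eq_right zero_le_one]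
  · have h' : (a : ℝ) = i := by exact_mod_cast h
    rw [if_pos h, Filter.EventuallyEq.deriv_eq (f := fun u => (m : ℝ) * u - a)]
    · simp
    · filter_upwards [ev] with u hu
      rw [axisPath, min_eq_right (by linarith [hu.2]), max_eq_right (by linarith [hu.1])]
  · have h' : (i : ℝ) + 1 ≤ a := by exact_mod_cast h
    rw [if_neg h.ne', Filter.EventuallyEq.deriv_eq (f := fun _ => (0 : ℝ)), deriv_const]
    filter_upwards [ev] with u hu
    rw [axisPath, min_eq_right (by linarith [hu.2]), max_eq_left (by linarith [hu.2])]

/-- Chen's identity along the path: on step `i` the signature is that of the completed steps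
convolved with that of a segment. Both sides satisfy the same differential equation on each step and
agree at the nodes. -/
theorem iteratedIntegral_axisPath {m : ℕ} (k : ℕ) (w : Fin k → Fin m) :
    ∀ i < m, ∀ t : ℝ, (i : ℝ) ≤ m * t → (m : ℝ) * t ≤ i + 1 →
      iteratedIntegral (axisPath m) k w t =
        conv (axisChar i) (expChar i (m * t - i)) (List.ofFn fun l => (w l : ℕ)) := by
  induction k with
  | zero =>
    intro i _ t _ _
    simp [iteratedIntegral, conv, (isCharacter_axisChar i).nil]
  | succ k ih =>
    intro i him
    have hm : (0 : ℝ) < m := by exact_mod_cast (Nat.zero_le i).trans_lt him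
    obtain ⟨W, hW⟩ : ∃ W, W = List.ofFn fun l : Fin k => (w l.castSucc : ℕ) := ⟨_, rfl⟩
    obtain ⟨a, ha⟩ : ∃ a, a = w (Fin.last k) := ⟨_, rfl⟩
    have hofn : (List.ofFn fun l => (w l : ℕ)) = W ++ [(a : ℕ)] := by
      rw [hW, ha, List.ofFn_succ_last]
    rw [hofn]
    let F : ℝ → ℝ := fun s => iteratedIntegral (axisPath m) k (fun j => w j.castSucc) s *
      deriv (fun u => axisPath m u (w (Fin.last k))) s
    have piece : ∀ i < m, ∀ t : ℝ, (i : ℝ) ≤ m * t → (m : ℝ) * t ≤ i + 1 →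
        IntervalIntegrable F MeasureTheory.volume (i / m) t ∧ ∫ s in (i / m : ℝ)..t, F s =
          conv (axisChar i) (expChar i (m * t - i)) (W ++ [(a : ℕ)]) -
            axisChar i (W ++ [(a : ℕ)]) := by
      intro i him t h1 h2
      have hle : (i / m : ℝ) ≤ t := by rwa [div_le_iff₀ hm, mul_comm]
      let G : ℝ → ℝ := fun s => (if (a : ℕ) = i then
        conv (axisChar i) (expChar i (m * s - i)) W else 0) * m
      -- The path has corners at the nodes, so the comparison is made only on the open interval.
      have hFG : ∀ s ∈ Set.Ioo (i / m : ℝ) t, F s = G s := by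
        rintro s ⟨hs1, hs2⟩
        have hs1' : (i : ℝ) < m * s := by rwa [div_lt_iff₀ hm, mul_comm] at hs1
        have hs2' : (m : ℝ) * s < i + 1 := (mul_lt_mul_of_pos_left hs2 hm).trans_le h2
        simp only [F, G]
        rw [ih (fun j => w j.castSucc) i him s hs1'.le hs2'.le, deriv_axisPath _ hs1' hs2', ← hW,
          ← ha]
        split_ifs <;> simp
      have hGc : Continuous G := by
        refine Continuous.mul ?_ continuous_const
        split_ifs
        · exact (continuous_conv_expChar _ i W).comp (by fun_prop)
        · exact continuous_const
      have hder : ∀ s, HasDerivAt (fun s : ℝ => conv (axisChar i) (expChar i (m * s - i))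
          (W ++ [(a : ℕ)])) (G s) s := by
        intro s
        have h := ((hasDerivAt_id' s).const_mul (m : ℝ)).sub_const (i : ℝ)
        rw [mul_one] at h
        exact (hasDerivAt_conv_expChar (axisChar i) i (m * s - i) W a).comp s h
      have hint : IntervalIntegrable F MeasureTheory.volume (i / m) t := by
        refine (hGc.intervalIntegrable (i / m) t).congr_uIoo fun s hs => ?_
        rw [Set.uIoo_of_le hle] at hs
        exact (hFG s hs).symm
      refine ⟨hint, ?_⟩
      rw [intervalIntegral.integral_eq_sub_of_hasDerivAt_of_le hle
        (fun s _ => (hder s).continuousAt.continuousWithinAt)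
        (fun s hs => by rw [hFG s hs]; exact hder s) hint]
      rw [mul_div_cancel₀ _ hm.ne', sub_self, conv_expChar_zero]
    have node : ∀ i ≤ m, IntervalIntegrable F MeasureTheory.volume 0 (i / m) ∧
        ∫ s in (0 : ℝ)..(i / m), F s = axisChar i (W ++ [(a : ℕ)]) := by
      intro i
      induction i with
      | zero =>
        intro _
        simp [axisChar, expChar_zero]
      | succ i ihi =>
        intro hi
        obtain ⟨n1, n2⟩ := ihi (by omega)
        have e : (m : ℝ) * (((i + 1 : ℕ) : ℝ) / m) = i + 1 := by
          rw [mul_div_cancel₀ _ hm.ne']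
          push_cast
          rfl
        obtain ⟨p1, p2⟩ := piece i (by omega) (((i + 1 : ℕ) : ℝ) / m) (by rw [e]; linarith)
          (by rw [e])
        refine ⟨n1.trans p1, ?_⟩
        rw [← intervalIntegral.integral_add_adjacent_intervals n1 p1, n2, p2, e, add_sub_cancel_left,
          add_sub_cancel, axisChar]
    intro t h1 h2
    obtain ⟨n1, n2⟩ := node i him.le
    obtain ⟨p1, p2⟩ := piece i him t h1 h2
    change ∫ s in (0 : ℝ)..t, F s = _
    rw [← intervalIntegral.integral_add_adjacent_intervals n1 p1, n2, p2, add_sub_cancel]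

theorem signatureTensor_axisPath {k m : ℕ} (hm : 1 ≤ m) (u : Fin k → Fin m) :
    signatureTensor k (axisPath m) u = axisLimit (List.ofFn fun l => (u l : ℕ)) := by
  obtain ⟨n, rfl⟩ : ∃ n, m = n + 1 := ⟨m - 1, by omega⟩
  -- Time `1` is the end of the last step, which has index `n = m - 1`.
  rw [signatureTensor, iteratedIntegral_axisPath k u n (by omega) 1 (by push_cast; linarith)
    (by push_cast; linarith), axisLimit_eq (n := n + 1), axisChar]
  · congr 2
    push_cast
    ring
  · intro a ha
    obtain ⟨l, rfl⟩ := (List.mem_ofFn' _ _).1 ha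
    exact (u l).2

end Axis

/-! ### The monomial path -/

section Mono

/-- The iterated integrals of monomials, relative to an initial exponent `s`. -/
noncomputable def monoAux : ℕ → List ℕ → ℝ
  | _, [] => 1
  | s, a :: w => ((a : ℝ) + 1) / (s + a + 1) * monoAux (s + a + 1) w

/-- The sum of the exponents of the coordinates of the monomial path in a word. -/
def monoWeight (w : List ℕ) : ℕ := (w.map fun a => a + 1).sum

theorem monoAux_append (s : ℕ) (u v : List ℕ) :
    monoAux s (u ++ v) = monoAux s u * monoAux (s + monoWeight u) v := by
  induction u generalizing s with
  | nil => simp [monoAux, monoWeight]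
  | cons a u ih =>
    rw [List.cons_append, monoAux, monoAux, ih, mul_assoc,
      show s + a + 1 + monoWeight u = s + monoWeight (a :: u) by simp [monoWeight]; ring]

theorem monoAux_mem_Icc (s : ℕ) (w : List ℕ) : monoAux s w ∈ Set.Icc (0 : ℝ) 1 := by
  induction w generalizing s with
  | nil => simp [monoAux]
  | cons a w ih =>
    obtain ⟨h0, h1⟩ := ih (s + a + 1)
    have h2 : ((a : ℝ) + 1) / (s + a + 1) ≤ 1 := by
      rw [div_le_one (by positivity)]
      linarith [(Nat.cast_nonneg s : (0 : ℝ) ≤ s)]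
    exact ⟨mul_nonneg (by positivity) h0, mul_le_one₀ h2 h0 h1⟩

theorem monoAux_append_singleton (w : List ℕ) (a : ℕ) :
    monoAux 0 (w ++ [a]) = monoAux 0 w * ((a + 1) / (monoWeight w + a + 1)) := by
  simp [monoAux_append, monoAux]

/-- Here the derivation corresponds to `t d/dt`: the iterated integral of a word is homogeneous in
`t`, of degree the sum of its exponents `a + 1`. -/
theorem isCharacter_monoAux : IsCharacter (monoAux 0) := by
  refine isCharacter_of_append_singleton (wt := fun a => (a : ℝ) + 1) (q := fun a => (a : ℝ) + 1)
    rfl (fun w a => ?_) fun a => by positivity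
  have h : (w.map fun a : ℕ => (a : ℝ) + 1).sum = monoWeight w := by
    rw [monoWeight, Nat.cast_list_sum, List.map_map]
    simp [Function.comp_def]
  rw [monoAux_append_singleton, List.map_append, List.sum_append, h, List.map_singleton,
    List.sum_singleton]
  field_simp
  ring

/-- With `W` the weight of `u`, a final letter `j` contributes `(j + 1) / (W + j + 1) → 1`. A letter
`b` right after `j` contributes `(b + 1) / (W + j + b + 2) → 0`, and all other factors stay in `[0,
1]`. -/
theorem isDegenerating_monoAux : IsDegenerating (monoAux 0) (monoAux 0) := by
  intro u v
  simp only [monoAux_append, zero_add]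
  rcases v with _ | ⟨b, v⟩
  · have h := (tendsto_natCast_div_add_atTop (monoWeight u : ℝ)).comp (tendsto_add_atTop_nat 1)
    have h' := h.const_mul (monoAux 0 u)
    rw [mul_one] at h'
    rw [if_pos rfl]
    refine h'.congr fun j => ?_
    simp only [monoAux, Function.comp_apply, mul_one]
    push_cast
    congr 2
    ring
  · rw [if_neg (by simp), ← mul_zero (monoAux 0 u)]
    refine Tendsto.const_mul _ ?_
    have h := (tendsto_one_div_add_atTop_nhds_zero_nat (𝕜 := ℝ)).const_mul ((b : ℝ) + 1)
    rw [mul_zero] at h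
    refine squeeze_zero (fun j => (monoAux_mem_Icc _ _).1) (fun j => ?_) h
    have h1 := monoAux_mem_Icc (monoWeight u + j + 1 + b + 1) v
    have h2 : ((j : ℝ) + 1) / (monoWeight u + j + 1) ≤ 1 := by
      rw [div_le_one (by positivity)]
      linarith [(Nat.cast_nonneg (monoWeight u) : (0 : ℝ) ≤ _)]
    have h3 : ((b : ℝ) + 1) / (((monoWeight u + j + 1 : ℕ) : ℝ) + b + 1) ≤
        (b + 1) * (1 / (j + 1)) := by
      rw [mul_one_div]
      push_cast
      gcongr
      linarith [(Nat.cast_nonneg (monoWeight u) : (0 : ℝ) ≤ _), (Nat.cast_nonneg b : (0 : ℝ) ≤ _)]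
    have h4 : (0 : ℝ) ≤ ((b : ℝ) + 1) / (((monoWeight u + j + 1 : ℕ) : ℝ) + b + 1) := by positivity
    rw [monoAux, monoAux]
    calc _ ≤ 1 * (((b : ℝ) + 1) / (((monoWeight u + j + 1 : ℕ) : ℝ) + b + 1) * 1) := by
          gcongr
          · exact mul_nonneg h4 h1.1
          · exact h1.2
      _ ≤ _ := by rw [one_mul, mul_one]; exact h3

theorem iteratedIntegral_monoPath {m : ℕ} (k : ℕ) (w : Fin k → Fin m) (t : ℝ) :
    iteratedIntegral (monoPath m) k w t = monoAux 0 (List.ofFn fun l => (w l : ℕ)) *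
      t ^ monoWeight (List.ofFn fun l => (w l : ℕ)) := by
  induction k generalizing t with
  | zero => simp [iteratedIntegral, monoAux, monoWeight]
  | succ k ih =>
    obtain ⟨W, hW⟩ : ∃ W, W = List.ofFn fun l : Fin k => (w l.castSucc : ℕ) := ⟨_, rfl⟩
    obtain ⟨a, ha⟩ : ∃ a, a = (w (Fin.last k) : ℕ) := ⟨_, rfl⟩
    have hofn : (List.ofFn fun l => (w l : ℕ)) = W ++ [a] := by
      rw [hW, ha, List.ofFn_succ_last]
    have hwt : monoWeight (W ++ [a]) = monoWeight W + a + 1 := by simp [monoWeight, add_assoc]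
    have hint : ∀ s, iteratedIntegral (monoPath m) k (fun j => w j.castSucc) s *
        deriv (fun u => monoPath m u (w (Fin.last k))) s =
        monoAux 0 W * (a + 1) * s ^ (monoWeight W + a) := by
      intro s
      rw [ih, ← hW]
      simp only [monoPath, ← ha, deriv_pow_field]
      push_cast
      ring
    rw [hofn, iteratedIntegral]
    simp only [hint]
    rw [intervalIntegral.integral_const_mul, integral_pow, monoAux_append_singleton, hwt]
    push_cast
    rw [zero_pow (Nat.succ_ne_zero _)]
    field_simp
    ring

theorem signatureTensor_monoPath {k m : ℕ} (u : Fin k → Fin m) :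
    signatureTensor k (monoPath m) u = monoAux 0 (List.ofFn fun l => (u l : ℕ)) := by
  rw [signatureTensor, iteratedIntegral_monoPath, one_pow, mul_one]

end Mono

/-! ### The two families of paths as instances of the general chain. -/

theorem plVariety_eq_sigVariety (K : Type*) [Field K] [Algebra ℝ K] (d k : ℕ) {m : ℕ}
    (hm : 1 ≤ m) : plVariety K d k m = sigVariety K axisLimit d k m := by
  rw [plVariety, range_matrixAct (signatureTensor_axisPath hm), sigVariety]

theorem polyVariety_eq_sigVariety (K : Type*) [Field K] [Algebra ℝ K] (d k m : ℕ) :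
    polyVariety K d k m = sigVariety K (monoAux 0) d k m := by
  rw [polyVariety, range_matrixAct signatureTensor_monoPath, sigVariety]

end SigVar

theorem theorem5p3 (d k : ℕ) (hd : 1 ≤ d) (hk : 1 ≤ k) :
    ∃ M M' : ℕ, 1 ≤ M ∧ 1 ≤ M' ∧
      ∀ (K : Type*) [Field K] [IsAlgClosed K] [Algebra ℝ K],
        (SigVar.veronese K d k = SigVar.plVariety K d k 1 ∧
          (∀ m : ℕ, 1 ≤ m → SigVar.plVariety K d k m ⊆ SigVar.plVariety K d k (m + 1)) ∧
          (∀ m : ℕ, M ≤ m → SigVar.plVariety K d k m = SigVar.universalVariety K d k)) ∧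
        (SigVar.veronese K d k = SigVar.polyVariety K d k 1 ∧
          (∀ m : ℕ, 1 ≤ m → SigVar.polyVariety K d k m ⊆ SigVar.polyVariety K d k (m + 1)) ∧
          (∀ m : ℕ, M' ≤ m → SigVar.polyVariety K d k m = SigVar.universalVariety K d k)) := by
  obtain ⟨M, hM, h⟩ := SigVar.exists_chain SigVar.axisLimit SigVar.isCharacter_axisLimit
    SigVar.isDegenerating_axisLimit (by simp [SigVar.axisLimit_singleton_zero]) hd hk
  obtain ⟨M', hM', h'⟩ := SigVar.exists_chain (SigVar.monoAux 0) SigVar.isCharacter_monoAux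
    SigVar.isDegenerating_monoAux (by simp [SigVar.monoAux]) hd hk
  refine ⟨M, M', hM, hM', fun K _ _ _ => ⟨?_, ?_⟩⟩
  · obtain ⟨h1, h2, h3⟩ := h K
    refine ⟨?_, fun m hm => ?_, fun m hm => ?_⟩
    · rw [SigVar.plVariety_eq_sigVariety K d k le_rfl, h1]
    · rw [SigVar.plVariety_eq_sigVariety K d k hm,
        SigVar.plVariety_eq_sigVariety K d k (Nat.le_add_left 1 m)]
      exact h2 m hm
    · rw [SigVar.plVariety_eq_sigVariety K d k (hM.trans hm), h3 m hm]
  · simp only [SigVar.polyVariety_eq_sigVariety]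
    exact h' K
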